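/- Let $(M,g,I_1,I_2,I_3,\omega_1,\omega_2,\omega_3)$ be a hyperkähler manifold, $\omega_i(X,Y)=g(I_iX,Y)$, and let $T$ be a vector field on $M$ which generates a smooth $\mathbb R$-action (that is, $T$ is complete), preserves the hyperkähler structure ($L_Tg=0$, $L_TI_i=0$, $L_T\omega_i=0$ for $i=1,2,3$) and has a global hyperkähler moment map $(x_1,x_2,x_3)\colon M\to\mathbb R^3$, $dx_i=-\iota_T\omega_i$; zeros of $T$ are allowed. Let $\mathbb H=\{q_0+q_1i+q_2j+q_3k\}$ carry the Euclidean metric and the complex structures given by left multiplication by $i,j,k$, and let $a>0$. Then $M\times\mathbb H$ with the product structure is hyperkähler, the vector field $Z=aT+\frac{\partial}{\partial q_0}$ generates an $\mathbb R$-action on it which preserves the hyperkähler structure, and $\mu=(ax_i-q_i)_{i=1,2,3}$ is a hyperkähler moment map of this action. Moreover there is a $T$-invariant hyperkähler structure $(g_a,I_1^a,I_2^a,I_3^a,\omega_1^a,\omega_2^a,\omega_3^a)$ on $M$ with the following properties. (1) For every $c\in\mathbb R^3$, $M$ with this structure is a hyperkähler quotient $\mu^{-1}(c)/\mathbb R$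 of $M\times\mathbb H$ (for a suitable quotient map $\mu^{-1}(c)\to M$), and for every hyperkähler quotient $Q=\mu^{-1}(c)/\mathbb R$ there is a diffeomorphism from $M$ to $Q$ which identifies $(g_a,I_i^a,\omega_i^a)$ with the hyperkähler structure of $Q$. In particular the structure $(g_a,I_i^a,\omega_i^a)$ does not depend on the level $c$ of the moment map. (2) On the open set $M'=\{T\ne 0\}$, for every cyclic permutation $(i,j,k)$ of $(1,2,3)$, $$g_a=\bar g+(V+a^2)\sum_{l=1}^3(dx_l)^2+\frac1{V+a^2}\eta^2,$$ $$I_i^a=I_i-\frac{a^2V}{a^2+V}\,\theta\otimes I_iT+a^2\,dx_i\otimes T,\qquad \omega_i^a=\omega_i+a^2\,dx_j\wedge dx_k,$$ where $V=1/g(T,T)$, $\theta=g(T,\cdot)$, $\eta=V\theta$ and $\bar g(X,Y)=g(X^\perp,Y^\perp)$, with $X^\perp$ the $g$-orthogonal projection of $X$ to the orthogonal complement of the span of $T,I_1T,I_2T,I_3T$. Here a hyperkähler quotient $\mu^{-1}(c)/\mathbb R$ (where $c$ is a regular value of $\mu$ and the action on $\mu^{-1}(c)$ is free) is a hyperkähler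 manifold $Q$ with a surjective smooth submersion $\pi\colon\mu^{-1}(c)\to Q$ whose fibres are the orbits of the $\mathbb R$-action, such that $\pi^*\omega_i^Q$ is the restriction to $\mu^{-1}(c)$ of the $i$-th Kähler form and $\pi$ is a Riemannian submersion. -/

import Mathlib

open Set Manifold
open scoped ContDiff Topology Quaternion

noncomputable section

/-! ## Hyperkähler structures -/

/-- The tensors of a hyperkähler structure on a manifold `M`: a bilinear form `g` and three
endomorphisms `J 0`, `J 1`, `J 2` of each tangent space, written `I₁`, `I₂`, `I₃` on paper. The
indices `1, 2, 3` of the paper notation are `0, 1, 2 : Fin 3`, with cyclic addition, so that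
`(i, i + 1, i + 2)` runs through the cyclic permutations of the three indices. The laws are in
`HyperkahlerData.IsHyperkahler`. -/
structure HyperkahlerData {E : Type*} [NormedAddCommGroup E] [NormedSpace ℝ E]
    {H : Type*} [TopologicalSpace H] (I : ModelWithCorners ℝ E H)
    (M : Type*) [TopologicalSpace M] [ChartedSpace H M] where
  /-- the metric -/
  g : ∀ m : M, TangentSpace I m →L[ℝ] TangentSpace I m →L[ℝ] ℝ
  /-- the three almost complex structures -/
  J : Fin 3 → ∀ m : M, TangentSpace I m →L[ℝ] TangentSpace I m

/-- The imaginary quaternions `i`, `j`, `k`. -/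
def quaternionUnit : Fin 3 → ℍ[ℝ] :=
  ![⟨0, 1, 0, 0⟩, ⟨0, 0, 1, 0⟩, ⟨0, 0, 0, 1⟩]

section General

variable {E : Type*} [NormedAddCommGroup E] [NormedSpace ℝ E]
  {H : Type*} [TopologicalSpace H] {I : ModelWithCorners ℝ E H}
  {M : Type*} [TopologicalSpace M] [ChartedSpace H M] [IsManifold I ∞ M]

/-- A smooth vector field. -/
def IsSmoothVectorField (X : ∀ m : M, TangentSpace I m) : Prop :=
  ContMDiff I I.tangent ∞ (fun m => (⟨m, X m⟩ : TangentBundle I M))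

namespace HyperkahlerData

/-- The `i`-th Kähler form `ω_i(X, Y) = g(I_i X, Y)`. -/
def kahlerForm (S : HyperkahlerData I M) (i : Fin 3) (m : M) (X Y : TangentSpace I m) : ℝ :=
  S.g m (S.J i m X) Y

/-- The exterior derivative `dω_i(X, Y, Z)` at `m`, for vector fields `X`, `Y`, `Z`. -/
def dKahlerForm (S : HyperkahlerData I M) (i : Fin 3) (X Y Z : ∀ m : M, TangentSpace I m) (m : M) : ℝ :=
  mvfderiv I (fun p => S.kahlerForm i p (Y p) (Z p)) m (X m)
    - mvfderiv I (fun p => S.kahlerForm i p (X p) (Z p)) m (Y m)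
    + mvfderiv I (fun p => S.kahlerForm i p (X p) (Y p)) m (Z m)
    - S.kahlerForm i m (VectorField.mlieBracket I X Y m) (Z m)
    + S.kahlerForm i m (VectorField.mlieBracket I X Z m) (Y m)
    - S.kahlerForm i m (VectorField.mlieBracket I Y Z m) (X m)

/-- The Nijenhuis tensor `N(X, Y) = [I_i X, I_i Y] - I_i [I_i X, Y] - I_i [X, I_i Y] - [X, Y]`
of the `i`-th almost complex structure. -/
def nijenhuis (S : HyperkahlerData I M) (i : Fin 3) (X Y : ∀ m : M, TangentSpace I m) (m : M) :
    TangentSpace I m :=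
  VectorField.mlieBracket I (fun p => S.J i p (X p)) (fun p => S.J i p (Y p)) m
    - S.J i m (VectorField.mlieBracket I (fun p => S.J i p (X p)) Y m)
    - S.J i m (VectorField.mlieBracket I X (fun p => S.J i p (Y p)) m)
    - VectorField.mlieBracket I X Y m

/-- `(g, I₁, I₂, I₃)` is a (smooth) hyperkähler structure: `g` is a Riemannian metric which is
Kähler with respect to each of the complex structures `I_i`, and these satisfy the quaternionic
relations. -/
structure IsHyperkahler (S : HyperkahlerData I M) : Prop where
  metric_smooth : ContMDiff I (I.prod 𝓘(ℝ, E →L[ℝ] E →L[ℝ] ℝ)) ∞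
    (fun m => Bundle.TotalSpace.mk' (E →L[ℝ] E →L[ℝ] ℝ)
      (E := fun m : M => TangentSpace I m →L[ℝ] TangentSpace I m →L[ℝ] ℝ) m (S.g m))
  metric_symm : ∀ (m : M) (X Y : TangentSpace I m), S.g m X Y = S.g m Y X
  metric_pos : ∀ (m : M) (X : TangentSpace I m), X ≠ 0 → 0 < S.g m X X
  J_smooth : ∀ i, ContMDiff I (I.prod 𝓘(ℝ, E →L[ℝ] E)) ∞
    (fun m => Bundle.TotalSpace.mk' (E →L[ℝ] E)
      (E := fun m : M => TangentSpace I m →L[ℝ] TangentSpace I m) m (S.J i m))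
  J_sq : ∀ (i : Fin 3) (m : M) (X : TangentSpace I m), S.J i m (S.J i m X) = -X
  J_mul : ∀ (i : Fin 3) (m : M) (X : TangentSpace I m),
    S.J i m (S.J (i + 1) m X) = S.J (i + 2) m X
  J_isometry : ∀ (i : Fin 3) (m : M) (X Y : TangentSpace I m),
    S.g m (S.J i m X) (S.J i m Y) = S.g m X Y
  J_integrable : ∀ (i : Fin 3) (X Y : ∀ m : M, TangentSpace I m),
    IsSmoothVectorField X → IsSmoothVectorField Y → ∀ m, S.nijenhuis i X Y m = 0
  kahlerForm_closed : ∀ (i : Fin 3) (X Y Z : ∀ m : M, TangentSpace I m),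
    IsSmoothVectorField X → IsSmoothVectorField Y → IsSmoothVectorField Z →
      ∀ m, S.dKahlerForm i X Y Z m = 0

/-! ## Actions of `ℝ` and moment maps -/

/-- The vector field generating the flow `φ` preserves the structure: `L_T g = 0`, `L_T I_i = 0`,
`L_T ω_i = 0`. The Lie derivative along `T` of a tensor field is the derivative at `t = 0` of its
pullback under `φ t`, at each point. -/
structure IsInvariant (S : HyperkahlerData I M) (φ : ℝ → M → M) : Prop where
  lie_g : ∀ (m : M) (X Y : TangentSpace I m),
    HasDerivAt (fun t : ℝ => S.g (φ t m) (mfderiv I I (φ t) m X) (mfderiv I I (φ t) m Y)) 0 0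
  lie_J : ∀ (i : Fin 3) (m : M) (X : TangentSpace I m),
    HasDerivAt (fun t : ℝ =>
      (mfderiv I I (φ (-t)) (φ t m) (S.J i (φ t m) (mfderiv I I (φ t) m X)) : E)) 0 0
  lie_kahlerForm : ∀ (i : Fin 3) (m : M) (X Y : TangentSpace I m),
    HasDerivAt (fun t : ℝ => S.kahlerForm i (φ t m) (mfderiv I I (φ t) m X) (mfderiv I I (φ t) m Y)) 0 0

/-- `φ` is a smooth action of `ℝ` with generator the vector field `T`, it preserves the
hyperkähler structure, and it is tri-Hamiltonian with (global) hyperkähler moment map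
`x = (x₁, x₂, x₃)`, that is `dx_i = -ι_T ω_i`. -/
structure IsTriHamiltonian (S : HyperkahlerData I M) (φ : ℝ → M → M)
    (T : ∀ m : M, TangentSpace I m) (x : Fin 3 → M → ℝ) : Prop where
  field_smooth : IsSmoothVectorField T
  action_smooth : ContMDiff (𝓘(ℝ, ℝ).prod I) I ∞ (fun p : ℝ × M => φ p.1 p.2)
  action_zero : ∀ m, φ 0 m = m
  action_add : ∀ s t m, φ (s + t) m = φ s (φ t m)
  generator : ∀ m, IsMIntegralCurve (I := I) (fun t => φ t m) T
  invariant : S.IsInvariant φ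
  moment_smooth : ∀ i, ContMDiff I 𝓘(ℝ, ℝ) ∞ (x i)
  moment : ∀ (i : Fin 3) (m : M) (Y : TangentSpace I m),
    mvfderiv I (x i) m Y = - S.kahlerForm i m (T m) Y

/-! ## The tensors attached to `T` -/

/-- `V = 1 / g(T, T)`. -/
def V (S : HyperkahlerData I M) (T : ∀ m : M, TangentSpace I m) (m : M) : ℝ :=
  1 / S.g m (T m) (T m)

/-- `θ = g(T, ·)`. -/
def θ (S : HyperkahlerData I M) (T : ∀ m : M, TangentSpace I m) (m : M)
    (X : TangentSpace I m) : ℝ :=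
  S.g m (T m) X

/-- `η = V θ`. -/
def η (S : HyperkahlerData I M) (T : ∀ m : M, TangentSpace I m) (m : M)
    (X : TangentSpace I m) : ℝ :=
  S.V T m * S.θ T m X

/-- Where `T ≠ 0`: the orthogonal projection `X^⊥` of `X` to the orthogonal complement of the
span `L` of `T, I₁T, I₂T, I₃T`; these four vectors are mutually orthogonal, of square norm
`g(T, T) = 1 / V` (see `perp_spec`). -/
def perp (S : HyperkahlerData I M) (T : ∀ m : M, TangentSpace I m) (m : M)
    (X : TangentSpace I m) : TangentSpace I m :=
  X - (S.V T m * S.g m (T m) X) • T m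
    - ∑ i : Fin 3, (S.V T m * S.g m (S.J i m (T m)) X) • S.J i m (T m)

/-- Where `T ≠ 0`, `S.perp T m X` is indeed the orthogonal projection of `X` to the orthogonal
complement of the span of `T, I₁T, I₂T, I₃T`. -/
theorem perp_spec (S : HyperkahlerData I M) (hS : S.IsHyperkahler)
    (T : ∀ m : M, TangentSpace I m) (m : M) (hT : T m ≠ 0) (X : TangentSpace I m) :
    X - S.perp T m X ∈
      Submodule.span ℝ (insert (T m) (Set.range fun i : Fin 3 => S.J i m (T m))) ∧
    S.g m (S.perp T m X) (T m) = 0 ∧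
    ∀ i : Fin 3, S.g m (S.perp T m X) (S.J i m (T m)) = 0 := by
  have hpos := (hS.metric_pos m (T m) hT).ne'
  have h0 : ∀ i, S.g m (S.J i m (T m)) (T m) = 0 := fun i => by
    have h := hS.J_isometry i m (S.J i m (T m)) (T m)
    rw [hS.J_sq, hS.metric_symm m (-T m)] at h
    simp only [map_neg] at h
    linarith
  have h1 : ∀ i, S.g m (S.J i m (T m)) (S.J i m (T m)) = S.g m (T m) (T m) :=
    fun i => hS.J_isometry i m _ _
  have h2 : ∀ i, S.g m (S.J i m (T m)) (S.J (i + 1) m (T m)) = 0 := fun i => by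
    have h := hS.J_isometry i m (S.J i m (T m)) (S.J (i + 1) m (T m))
    rw [hS.J_sq, hS.J_mul, hS.metric_symm] at h
    simp only [map_neg] at h
    rw [h0] at h
    linarith
  have h3 : ∀ i, S.g m (S.J (i + 1) m (T m)) (S.J i m (T m)) = 0 := fun i => by
    rw [hS.metric_symm, h2]
  have a1 := h2 0
  have a2 := h2 1
  have a3 := h2 2
  have b1 := h3 0
  have b2 := h3 1
  have b3 := h3 2
  have e1 : (0 : Fin 3) + 1 = 1 := rfl
  have e2 : (1 : Fin 3) + 1 = 2 := rfl
  have e3 : (2 : Fin 3) + 1 = 0 := rfl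
  rw [e1] at a1 b1
  rw [e2] at a2 b2
  rw [e3] at a3 b3
  refine ⟨?_, ?_, fun i => ?_⟩
  · have : X - S.perp T m X = (S.V T m * S.g m (T m) X) • T m
        + ∑ i : Fin 3, (S.V T m * S.g m (S.J i m (T m)) X) • S.J i m (T m) := by
      unfold perp
      abel
    rw [this]
    refine add_mem (Submodule.smul_mem _ _ (Submodule.subset_span (Set.mem_insert _ _)))
      (Submodule.sum_mem _ fun i _ => Submodule.smul_mem _ _ (Submodule.subset_span ?_))
    exact Set.mem_insert_of_mem _ ⟨i, rfl⟩
  · rw [hS.metric_symm]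
    simp only [perp, V, Fin.sum_univ_three, map_sub, map_add, map_smul, smul_eq_mul,
      hS.metric_symm m (T m) (S.J _ m (T m)), h0]
    field_simp
    ring
  · rw [hS.metric_symm]
    fin_cases i <;>
    · simp only [perp, V, Fin.sum_univ_three, map_sub, map_add, map_smul, smul_eq_mul, h0, h1,
        Fin.zero_eta, Fin.mk_one, Fin.reduceFinMk, a1, a2, a3, b1, b2, b3]
      field_simp
      ring

/-- `ḡ(X, Y) = g(X^⊥, Y^⊥)`. -/
def gBar (S : HyperkahlerData I M) (T : ∀ m : M, TangentSpace I m) (m : M)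
    (X Y : TangentSpace I m) : ℝ :=
  S.g m (S.perp T m X) (S.perp T m Y)

/-! ## Hyperkähler quotients -/

/-- The level set `μ⁻¹(c)` of a hyperkähler moment map. -/
def levelSet {N : Type*} (μ : Fin 3 → N → ℝ) (c : Fin 3 → ℝ) : Set N :=
  {n | ∀ i, μ i n = c i}

/-- Let `ψ` be an action of `ℝ` on `M` with generator `Z`, which is tri-Hamiltonian with moment map
`μ` for the hyperkähler structure `S`. The manifold `Q` with the structure `SQ` is the hyperkähler
quotient `μ⁻¹(c) / ℝ`, with quotient map `π : μ⁻¹(c) → Q` (the values of `π` elsewhere are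
irrelevant): `c` is a regular value of `μ`, so that `μ⁻¹(c)` is a submanifold with tangent
spaces `⋂ ker dμ_i`, and `ℝ` acts freely on it; `π` is a surjective smooth
submersion whose fibres are the orbits, so that `Q` is the orbit space as a smooth manifold;
`π^* ω_i^Q` is the restriction of `ω_i` to `μ⁻¹(c)`, and `π` is a Riemannian submersion.
In `submersion`, `D` is a derivative of `π` along the level set at `n`; only the restriction of `D`
to the tangent space of the level set is determined by `π`, and only this restriction, the
differential of `π` as a map on `μ⁻¹(c)`, is used. -/
structure IsQuotient (S : HyperkahlerData I M) (ψ : ℝ → M → M) (Z : ∀ m : M, TangentSpace I m)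
    (μ : Fin 3 → M → ℝ) (c : Fin 3 → ℝ)
    {E' : Type*} [NormedAddCommGroup E'] [NormedSpace ℝ E']
    {H' : Type*} [TopologicalSpace H'] {I' : ModelWithCorners ℝ E' H'}
    {Q : Type*} [TopologicalSpace Q] [ChartedSpace H' Q]
    [IsManifold I' ∞ Q] (SQ : HyperkahlerData I' Q) (π : M → Q) : Prop where
  hyperkahler : SQ.IsHyperkahler
  regular : ∀ n ∈ levelSet μ c, LinearIndependent ℝ (fun i : Fin 3 => mvfderiv I (μ i) n)
  free : ∀ n ∈ levelSet μ c, ∀ t, ψ t n = n → t = 0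
  surjective : ∀ q : Q, ∃ n ∈ levelSet μ c, π n = q
  fibres : ∀ n ∈ levelSet μ c, ∀ n' ∈ levelSet μ c, π n = π n' ↔ ∃ t, ψ t n = n'
  smooth : ContMDiffOn I I' ∞ π (levelSet μ c)
  submersion : ∀ n ∈ levelSet μ c, ∃ D : TangentSpace I n →L[ℝ] TangentSpace I' (π n),
    HasMFDerivWithinAt I I' π (levelSet μ c) n D ∧
    (∀ v : TangentSpace I' (π n), ∃ X : TangentSpace I n,
      (∀ i, mvfderiv I (μ i) n X = 0) ∧ D X = v) ∧
    (∀ (i : Fin 3) (X Y : TangentSpace I n),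
      (∀ j, mvfderiv I (μ j) n X = 0) → (∀ j, mvfderiv I (μ j) n Y = 0) →
        SQ.kahlerForm i (π n) (D X) (D Y) = S.kahlerForm i n X Y) ∧
    (∀ X Y : TangentSpace I n,
      (∀ j, mvfderiv I (μ j) n X = 0) → (∀ j, mvfderiv I (μ j) n Y = 0) →
      S.g n (Z n) X = 0 → S.g n (Z n) Y = 0 →
        SQ.g (π n) (D X) (D Y) = S.g n X Y)

/-- The diffeomorphism `Φ` identifies the structure `S` on `M` with the structure `SQ` on `Q`:
it intertwines the metrics and the complex structures, hence also the Kähler forms. -/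
def IsIso (S : HyperkahlerData I M)
    {E' : Type*} [NormedAddCommGroup E'] [NormedSpace ℝ E']
    {H' : Type*} [TopologicalSpace H'] {I' : ModelWithCorners ℝ E' H'}
    {Q : Type*} [TopologicalSpace Q] [ChartedSpace H' Q]
    [IsManifold I' ∞ Q] (SQ : HyperkahlerData I' Q) (Φ : M ≃ₘ^∞⟮I, I'⟯ Q) : Prop :=
  (∀ (m : M) (X Y : TangentSpace I m),
    SQ.g (Φ m) (mfderiv I I' Φ m X) (mfderiv I I' Φ m Y) = S.g m X Y) ∧
  (∀ (i : Fin 3) (m : M) (X : TangentSpace I m),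
    mfderiv I I' Φ m (S.J i m X) = SQ.J i (Φ m) (mfderiv I I' Φ m X)) ∧
  (∀ (i : Fin 3) (m : M) (X Y : TangentSpace I m),
    SQ.kahlerForm i (Φ m) (mfderiv I I' Φ m X) (mfderiv I I' Φ m Y) = S.kahlerForm i m X Y)

/-! ## The product with the quaternions -/

/-- The product of the hyperkähler structure `S` on `M` with the standard structure of `ℍ`: the
Euclidean metric and left multiplication by `i`, `j`, `k`. -/
def prodQuaternion (S : HyperkahlerData I M) :
    HyperkahlerData (I.prod 𝓘(ℝ, ℍ[ℝ])) (M × ℍ[ℝ]) where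
  g p :=
    let g₁ : E →L[ℝ] E →L[ℝ] ℝ := S.g p.1
    let g₂ : ℍ[ℝ] →L[ℝ] ℍ[ℝ] →L[ℝ] ℝ := innerSL ℝ
    (g₁.bilinearComp (ContinuousLinearMap.fst ℝ E ℍ[ℝ]) (ContinuousLinearMap.fst ℝ E ℍ[ℝ]) +
      g₂.bilinearComp (ContinuousLinearMap.snd ℝ E ℍ[ℝ]) (ContinuousLinearMap.snd ℝ E ℍ[ℝ]) :
      E × ℍ[ℝ] →L[ℝ] E × ℍ[ℝ] →L[ℝ] ℝ)
  J i p :=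
    let J₁ : E →L[ℝ] E := S.J i p.1
    (J₁.prodMap (ContinuousLinearMap.mul ℝ ℍ[ℝ] (quaternionUnit i)) : E × ℍ[ℝ] →L[ℝ] E × ℍ[ℝ])

end HyperkahlerData

/-- The vector field `Z = a T + ∂/∂q₀` on `M × ℍ`. -/
def taubNUTField (a : ℝ) (T : ∀ m : M, TangentSpace I m) (p : M × ℍ[ℝ]) :
    TangentSpace (I.prod 𝓘(ℝ, ℍ[ℝ])) p :=
  ((a • T p.1, 1) : E × ℍ[ℝ])

end General

/-- The action of `ℝ` on `M × ℍ` generated by `a T + ∂/∂q₀`, where `φ` is the action on `M` generated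
by `T`. -/
def taubNUTAction {M : Type*} (a : ℝ) (φ : ℝ → M → M) (t : ℝ) (p : M × ℍ[ℝ]) : M × ℍ[ℝ] :=
  (φ (a * t) p.1, p.2 + (t : ℍ[ℝ]))

/-- The hyperkähler moment map `(a x_i - q_i)_{i = 1, 2, 3}` on `M × ℍ`. -/
def taubNUTMoment {M : Type*} (a : ℝ) (x : Fin 3 → M → ℝ) (i : Fin 3) (p : M × ℍ[ℝ]) : ℝ :=
  a * x i p.1 - ![p.2.imI, p.2.imJ, p.2.imK] i

end

/-!
The theorem asserts that the Taub-NUT modification of a hyperkähler structure along a tri-Hamiltonian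
field `T` is, at every level, the hyperkähler quotient of `M × ℍ` by the action of
`a T + ∂/∂q₀`.

The modified structure is written down directly, in a form which makes sense at the zeros of `T`:
with `s = a² / (1 + a² g(T, T))`, `θ = g(T, ·)` and `α_i = g(I_i T, ·) = -dx_i`, it is
`g + a² ∑ α_i² - s θ²` with complex structures `I_i - s θ ⊗ I_i T - a² α_i ⊗ T`
(`HyperkahlerData.taubNUT`). The algebraic laws are identities between these tensors, and the
Kähler forms are `ω_i + a² dx_{i+1} ∧ dx_{i+2}`, hence closed. Integrability needs no further
computation: by Hitchin's lemma, an almost hyperhermitian structure with closed Kähler forms is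
hyperkähler (`HyperkahlerData.IsAlmostHyperhermitian.isHyperkahler`). The same lemma reduces the
product `M × ℍ` to the closedness of its Kähler forms, which is checked on fields with constant
`ℍ`-part.

Each orbit in the level set `μ⁻¹(c)` meets `{q₀ = 0}` exactly once, and on the level set the
condition `q₀ = 0` leaves `m ∈ M` free and determines `q` by `q_i = a x_i(m) - c_i`. So the map
`(m, q) ↦ φ_{-a q₀}(m)` (`taubNUTProj`) is a quotient map onto `M`. Its differential is
`(X, p) ↦ dφ(X - a p₀ T)`, and since the flow preserves the modified structure
(`IsTriHamiltonian.pullback_flow_eq` integrates the infinitesimal invariance), the quotient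
conditions are pointwise identities (`taubNUT_kahlerForm_sub_smul`, `taubNUT_g_sub_smul`).

Conversely, the slice `m ↦ (m, ∑ (a x_i(m) - c_i) e_i)` (`taubNUTSlice`) composed with the quotient
map of an arbitrary quotient `Q` is a smooth bijection `M → Q` that matches the Kähler forms. Its
differential is injective because the forms are nondegenerate, and surjective because a quotient map
kills the generator of the action, so it is a diffeomorphism by the inverse function theorem. The
three Kähler forms determine the complex structures and the metric (`isIso_of_kahlerForm`).
-/

noncomputable section

/-! ### Vector fields and functions -/

section VectorFields

variable {E : Type*} [NormedAddCommGroup E] [NormedSpace ℝ E]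
  {H : Type*} [TopologicalSpace H] {I : ModelWithCorners ℝ E H}
  {M : Type*} [TopologicalSpace M] [ChartedSpace H M]

/-- Read in the chart at `m`, the derivative of `f` along a vector field is the derivative of the
coordinate expression of `f` along the coordinate expression of the field. -/
theorem mvfderiv_extChartAt_symm_apply [IsManifold I ∞ M] [I.Boundaryless]
    {F : Type*} [NormedAddCommGroup F] [NormedSpace ℝ F] {f : M → F} {m : M} {y : E}
    (hy : y ∈ (extChartAt I m).target)
    (hf : MDifferentiableAt I 𝓘(ℝ, F) f ((extChartAt I m).symm y))
    (X : ∀ m : M, TangentSpace I m) :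
    mvfderiv I f ((extChartAt I m).symm y) (X ((extChartAt I m).symm y)) =
      fderiv ℝ (f ∘ (extChartAt I m).symm) y
        (VectorField.mpullbackWithin 𝓘(ℝ, E) I (extChartAt I m).symm X (range I) y) := by
  have hI : range I = univ := I.range_eq_univ
  have : IsManifold I 1 M := .of_le (n := ∞) (by simp)
  have hinv := isInvertible_mfderivWithin_extChartAt_symm (I := I) hy
  have hd : MDifferentiableAt 𝓘(ℝ, E) I (extChartAt I m).symm y := by
    have := mdifferentiableWithinAt_extChartAt_symm (I := I) hy
    rwa [hI, mdifferentiableWithinAt_univ] at this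
  have h : fderiv ℝ (f ∘ (extChartAt I m).symm) y =
      (mvfderiv I f ((extChartAt I m).symm y)).comp (mfderiv 𝓘(ℝ, E) I (extChartAt I m).symm y) := by
    rw [← mfderiv_eq_fderiv]
    exact mfderiv_comp y hf hd
  have hinv' := hinv.self_apply_inverse (X ((extChartAt I m).symm y))
  rw [hI, mfderivWithin_univ] at hinv'
  rw [h, VectorField.mpullbackWithin_apply, hI, mfderivWithin_univ]
  exact (congrArg (mvfderiv I f ((extChartAt I m).symm y)) hinv').symm

/-- The coordinate expression of a vector field, at the centre of the chart. -/
theorem mpullbackWithin_extChartAt_symm_self [IsManifold I ∞ M] [I.Boundaryless]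
    (X : ∀ m : M, TangentSpace I m) (m : M) :
    (VectorField.mpullbackWithin 𝓘(ℝ, E) I (extChartAt I m).symm X (range I) (extChartAt I m m) : E)
      = X m := by
  have : IsManifold I 1 M := .of_le (n := ∞) (by simp)
  rw [VectorField.mpullbackWithin_apply, mfderivWithin_range_extChartAt_symm]
  refine (congrArg (fun L : E →L[ℝ] E => L (X ((extChartAt I m).symm (extChartAt I m m))))
    ContinuousLinearMap.inverse_id).trans ?_
  change X _ = _
  rw [extChartAt_to_inv]

/-- The derivative of a function, computed in the chart at the point. -/
theorem mvfderiv_eq_fderiv_extChartAt_symm [IsManifold I ∞ M] [I.Boundaryless]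
    {F : Type*} [NormedAddCommGroup F] [NormedSpace ℝ F] {g : M → F} {m : M}
    (hg : DifferentiableAt ℝ (g ∘ (extChartAt I m).symm) (extChartAt I m m)) :
    (mvfderiv I g m : E →L[ℝ] F) =
      fderiv ℝ (g ∘ (extChartAt I m).symm) (extChartAt I m m) := by
  have : IsManifold I 1 M := .of_le (n := ∞) (by simp)
  have hd : MDifferentiableAt I 𝓘(ℝ, E) (extChartAt I m) m :=
    mdifferentiableAt_extChartAt (mem_chart_source H m)
  have h1 : MDifferentiableAt I 𝓘(ℝ, F) ((g ∘ (extChartAt I m).symm) ∘ extChartAt I m) m :=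
    hg.mdifferentiableAt.comp m hd
  have h2 : g =ᶠ[𝓝 m] (g ∘ (extChartAt I m).symm) ∘ extChartAt I m := by
    filter_upwards [extChartAt_source_mem_nhds (I := I) m] with p hp
    exact (congrArg g ((extChartAt I m).left_inv hp)).symm
  have h3 := h1.congr_of_eventuallyEq h2
  rw [h3.mvfderiv, I.range_eq_univ, fderivWithin_univ]
  rfl

/-- The bracket of vector fields is the commutator of the corresponding derivations. -/
theorem mvfderiv_mlieBracket [IsManifold I ∞ M] [I.Boundaryless] [CompleteSpace E]
    {F : Type*} [NormedAddCommGroup F] [NormedSpace ℝ F] {f : M → F} {m : M}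
    (hf : ContMDiffAt I 𝓘(ℝ, F) 2 f m) {X Y : ∀ m : M, TangentSpace I m}
    (hX : MDifferentiableAt I I.tangent (fun p => (⟨p, X p⟩ : TangentBundle I M)) m)
    (hY : MDifferentiableAt I I.tangent (fun p => (⟨p, Y p⟩ : TangentBundle I M)) m) :
    mvfderiv I f m (VectorField.mlieBracket I X Y m) =
      mvfderiv I (fun p => mvfderiv I f p (Y p)) m (X m) -
        mvfderiv I (fun p => mvfderiv I f p (X p)) m (Y m) := by
  have : IsManifold I 2 M := .of_le (n := ∞) (WithTop.coe_le_coe.2 (le_top : (2 : ℕ∞) ≤ ⊤))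
  have : IsManifold I 1 M := .of_le (n := ∞) (by simp)
  have hI : range I = univ := I.range_eq_univ
  set y₀ := extChartAt I m m with hy₀
  set ψ := (extChartAt I m).symm with hψ
  set f' : E → F := f ∘ ψ with hf'
  have hf2 : ContDiffAt ℝ 2 f' y₀ := by
    have := (contMDiffAt_iff.1 hf).2
    rw [hI, contDiffWithinAt_univ] at this
    exact this
  -- the coordinate expression of a differentiable field is differentiable, and so is the
  -- derivative of `f` along it
  have key : ∀ Z : ∀ m : M, TangentSpace I m,
      MDifferentiableAt I I.tangent (fun p => (⟨p, Z p⟩ : TangentBundle I M)) m →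
      DifferentiableAt ℝ (VectorField.mpullbackWithin 𝓘(ℝ, E) I ψ Z (range I)) y₀ ∧
      ∀ v : E, mvfderiv I (fun p => mvfderiv I f p (Z p)) m v =
        fderiv ℝ (fderiv ℝ f') y₀ v (Z m) +
          fderiv ℝ f' y₀ (fderiv ℝ (VectorField.mpullbackWithin 𝓘(ℝ, E) I ψ Z (range I)) y₀ v) := by
    intro Z hZ
    have hZ' : DifferentiableAt ℝ (VectorField.mpullbackWithin 𝓘(ℝ, E) I ψ Z (range I)) y₀ := by
      rw [← mdifferentiableWithinAt_univ] at hZ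
      have := hZ.differentiableWithinAt_mpullbackWithin_vectorField
      rw [preimage_univ, univ_inter] at this
      exact this.differentiableAt (by simp [hI])
    refine ⟨hZ', fun v => ?_⟩
    have hev : (fun p => mvfderiv I f p (Z p)) ∘ ψ =ᶠ[𝓝 y₀] fun y =>
        fderiv ℝ f' y (VectorField.mpullbackWithin 𝓘(ℝ, E) I ψ Z (range I) y) := by
      have h1 : ∀ᶠ p in 𝓝 m, ContMDiffAt I 𝓘(ℝ, F) 2 f p :=
        contMDiffAt_iff_contMDiffAt_nhds (by simp) |>.1 hf
      have h2 : ContinuousAt ψ y₀ := continuousAt_extChartAt_symm m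
      have h3 : ψ y₀ = m := extChartAt_to_inv m
      have h4 : ∀ᶠ y in 𝓝 y₀, ContMDiffAt I 𝓘(ℝ, F) 2 f (ψ y) :=
        h2.eventually (by rwa [h3])
      filter_upwards [h4, extChartAt_target_mem_nhds (I := I) m] with y hy hy'
      exact mvfderiv_extChartAt_symm_apply hy' (hy.mdifferentiableAt (by simp)) Z
    have hd2 : DifferentiableAt ℝ (fderiv ℝ f') y₀ :=
      (hf2.fderiv_right (m := 1) (by norm_num)).differentiableAt (by simp)
    have hd3 := hd2.clm_apply hZ'
    have hd4 : DifferentiableAt ℝ ((fun p => mvfderiv I f p (Z p)) ∘ ψ) y₀ :=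
      hd3.congr_of_eventuallyEq hev
    have h5 := congrArg (fun L : E →L[ℝ] F => L v) (mvfderiv_eq_fderiv_extChartAt_symm hd4)
    refine h5.trans ?_
    rw [hev.fderiv_eq]
    have h6 := (hd2.hasFDerivAt.clm_apply hZ'.hasFDerivAt).fderiv
    refine (congrArg (fun L : E →L[ℝ] F => L v) h6).trans ?_
    refine (add_comm _ _).trans ?_
    exact congrArg (fun w : E => fderiv ℝ (fderiv ℝ f') y₀ v w +
      fderiv ℝ f' y₀ (fderiv ℝ (VectorField.mpullbackWithin 𝓘(ℝ, E) I ψ Z (range I)) y₀ v))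
      (mpullbackWithin_extChartAt_symm_self Z m)
  obtain ⟨dX, kX⟩ := key X hX
  obtain ⟨dY, kY⟩ := key Y hY
  have hb : (VectorField.mlieBracket I X Y m : E) =
      fderiv ℝ (VectorField.mpullbackWithin 𝓘(ℝ, E) I ψ Y (range I)) y₀ (X m) -
      fderiv ℝ (VectorField.mpullbackWithin 𝓘(ℝ, E) I ψ X (range I)) y₀ (Y m) := by
    rw [← VectorField.mlieBracketWithin_univ, VectorField.mlieBracketWithin_apply,
      mfderiv_extChartAt_self]
    rw [preimage_univ, univ_inter]
    refine (congrArg (fun L : E →L[ℝ] E => L _) ContinuousLinearMap.inverse_id).trans ?_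
    change VectorField.lieBracketWithin ℝ _ _ _ _ = _
    rw [hI]
    refine (congrFun VectorField.lieBracketWithin_univ y₀).trans ?_
    have e1 := mpullbackWithin_extChartAt_symm_self X m
    have e2 := mpullbackWithin_extChartAt_symm_self Y m
    rw [hI] at e1 e2
    exact congrArg₂ (fun a b : E =>
      fderiv ℝ (VectorField.mpullbackWithin 𝓘(ℝ, E) I ψ Y univ) y₀ a -
      fderiv ℝ (VectorField.mpullbackWithin 𝓘(ℝ, E) I ψ X univ) y₀ b) e1 e2
  have hL := congrArg (fun L : E →L[ℝ] F => L (VectorField.mlieBracket I X Y m))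
    (mvfderiv_eq_fderiv_extChartAt_symm (hf2.differentiableAt (by simp)))
  refine hL.trans ?_
  have hsymm : IsSymmSndFDerivAt ℝ f' y₀ := hf2.isSymmSndFDerivAt (by simp)
  have hs := hsymm.eq (X m) (Y m)
  have hk1 := kY (X m)
  have hk2 := kX (Y m)
  refine Eq.trans ?_ (congrArg₂ (fun a b : F => a - b) hk1 hk2).symm
  change fderiv ℝ f' y₀ (VectorField.mlieBracket I X Y m) = _
  rw [hb, map_sub]
  have hs' : fderiv ℝ (fderiv ℝ f') y₀ (X m) (Y m) = fderiv ℝ (fderiv ℝ f') y₀ (Y m) (X m) := hs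
  rw [hs']
  abel

end VectorFields

/-! ### Smooth sections -/

section Sections

open Bundle

variable {E : Type*} [NormedAddCommGroup E] [NormedSpace ℝ E]
  {H : Type*} [TopologicalSpace H] {I : ModelWithCorners ℝ E H}
  {M : Type*} [TopologicalSpace M] [ChartedSpace H M]

/-- A section of a bundle of homomorphisms is smooth as soon as it maps smooth sections to smooth
sections. -/
theorem contMDiffAt_hom_section {n : WithTop ℕ∞} {F₁ F₂ : Type*} [NormedAddCommGroup F₁]
    [NormedSpace ℝ F₁] [FiniteDimensional ℝ F₁] [NormedAddCommGroup F₂] [NormedSpace ℝ F₂]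
    {V₁ V₂ : M → Type*} [TopologicalSpace (TotalSpace F₁ V₁)] [TopologicalSpace (TotalSpace F₂ V₂)]
    [∀ x, AddCommGroup (V₁ x)] [∀ x, Module ℝ (V₁ x)] [∀ x, TopologicalSpace (V₁ x)]
    [∀ x, AddCommGroup (V₂ x)] [∀ x, Module ℝ (V₂ x)] [∀ x, TopologicalSpace (V₂ x)]
    [∀ x, IsTopologicalAddGroup (V₂ x)] [∀ x, ContinuousSMul ℝ (V₂ x)]
    [FiberBundle F₁ V₁] [VectorBundle ℝ F₁ V₁] [FiberBundle F₂ V₂] [VectorBundle ℝ F₂ V₂]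
    {A : ∀ x, V₁ x →L[ℝ] V₂ x} {x₀ : M}
    (h : ∀ σ : ∀ x, V₁ x, ContMDiffAt I (I.prod 𝓘(ℝ, F₁)) n (fun x => TotalSpace.mk' F₁ x (σ x)) x₀ →
      ContMDiffAt I (I.prod 𝓘(ℝ, F₂)) n (fun x => TotalSpace.mk' F₂ x (A x (σ x))) x₀) :
    ContMDiffAt I (I.prod 𝓘(ℝ, F₁ →L[ℝ] F₂)) n
      (fun x => TotalSpace.mk' (F₁ →L[ℝ] F₂) (E := fun x => V₁ x →L[ℝ] V₂ x) x (A x)) x₀ := by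
  refine (contMDiffAt_hom_bundle _).2 ⟨contMDiffAt_id, ?_⟩
  set Φ : M → F₁ →L[ℝ] F₂ := fun x =>
    ContinuousLinearMap.inCoordinates F₁ V₁ F₂ V₂ x₀ x x₀ x (A x) with hΦ
  let b := Module.finBasis ℝ F₁
  -- `Φ` is a combination of its values on a basis of `F₁`, and these are coordinate expressions of
  -- `A` applied to local sections
  have hsum : Φ = fun x => ∑ i, (ContinuousLinearMap.smulRightL ℝ F₁ F₂
      (LinearMap.toContinuousLinearMap (b.coord i))) (Φ x (b i)) := by
    funext x
    ext v
    conv_lhs => rw [← b.sum_repr v, map_sum]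
    simp
  have hx₁ := FiberBundle.mem_baseSet_trivializationAt F₁ V₁ x₀
  have hx₂ := FiberBundle.mem_baseSet_trivializationAt F₂ V₂ x₀
  have hi : ∀ w : F₁, ContMDiffAt I 𝓘(ℝ, F₂) n (fun x => Φ x w) x₀ := by
    intro w
    have h1 := h _ (FiberBundle.contMDiffAt_extend I F₁ ((trivializationAt F₁ V₁ x₀).symm x₀ w))
    have h2 := (contMDiffAt_totalSpace.1 h1).2
    refine h2.congr_of_eventuallyEq ?_
    filter_upwards [(trivializationAt F₁ V₁ x₀).open_baseSet.mem_nhds hx₁,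
      (trivializationAt F₂ V₂ x₀).open_baseSet.mem_nhds hx₂] with x h1 h2
    simp only [hΦ, ContinuousLinearMap.inCoordinates_eq h1 h2]
    simp [FiberBundle.extend, Trivialization.apply_mk_symm _ hx₁]
  change ContMDiffAt I 𝓘(ℝ, F₁ →L[ℝ] F₂) n Φ x₀
  rw [hsum]
  refine contMDiffAt_finsetSum fun i _ => ?_
  exact (ContinuousLinearMap.contMDiff _).contMDiffAt.comp x₀ (hi (b i))

/-- Every tangent vector is the value of a globally defined smooth vector field. -/
theorem exists_isSmoothVectorField_eq [IsManifold I ∞ M] [FiniteDimensional ℝ E] [T2Space M]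
    (m : M) (v : TangentSpace I m) :
    ∃ X : ∀ m : M, TangentSpace I m, IsSmoothVectorField X ∧ X m = v := by
  obtain ⟨f⟩ : Nonempty (SmoothBumpFunction I m) := inferInstance
  -- cut off a local extension of `v` by a bump function
  refine ⟨fun p => f p • FiberBundle.extend E v p, fun p => ?_, by simp⟩
  by_cases hp : p ∈ tsupport f
  · have hp' : p ∈ (trivializationAt E (TangentSpace I) m).baseSet := by
      simpa using f.tsupport_subset_chartAt_source hp
    refine ContMDiffAt.smul_section f.contMDiffAt ?_
    rw [(trivializationAt E (TangentSpace I) m).contMDiffAt_section_iff hp']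
    refine (contMDiffAt_const (c := (trivializationAt E (TangentSpace I) m ⟨m, v⟩).2)
      ).congr_of_eventuallyEq ?_
    filter_upwards [(trivializationAt E (TangentSpace I) m).open_baseSet.mem_nhds hp'] with q hq
    simp [FiberBundle.extend, Trivialization.apply_mk_symm _ hq]
  · refine (contMDiff_zeroSection ℝ (TangentSpace I) p).congr_of_eventuallyEq ?_
    filter_upwards [notMem_tsupport_iff_eventuallyEq.1 hp] with q hq
    simp [hq, zeroSection]

end Sections

/-! ### Closed Kähler forms and integrability -/

namespace HyperkahlerData

variable {E : Type*} [NormedAddCommGroup E] [NormedSpace ℝ E]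
  {H : Type*} [TopologicalSpace H] {I : ModelWithCorners ℝ E H}
  {M : Type*} [TopologicalSpace M] [ChartedSpace H M] [IsManifold I ∞ M]

/-- A smooth Riemannian metric with three almost complex structures which are isometries and satisfy
the quaternionic relations; no integrability is required. -/
structure IsAlmostHyperhermitian (S : HyperkahlerData I M) : Prop where
  metric_smooth : ContMDiff I (I.prod 𝓘(ℝ, E →L[ℝ] E →L[ℝ] ℝ)) ∞
    (fun m => Bundle.TotalSpace.mk' (E →L[ℝ] E →L[ℝ] ℝ)
      (E := fun m : M => TangentSpace I m →L[ℝ] TangentSpace I m →L[ℝ] ℝ) m (S.g m))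
  metric_symm : ∀ (m : M) (X Y : TangentSpace I m), S.g m X Y = S.g m Y X
  metric_pos : ∀ (m : M) (X : TangentSpace I m), X ≠ 0 → 0 < S.g m X X
  J_smooth : ∀ i, ContMDiff I (I.prod 𝓘(ℝ, E →L[ℝ] E)) ∞
    (fun m => Bundle.TotalSpace.mk' (E →L[ℝ] E)
      (E := fun m : M => TangentSpace I m →L[ℝ] TangentSpace I m) m (S.J i m))
  J_sq : ∀ (i : Fin 3) (m : M) (X : TangentSpace I m), S.J i m (S.J i m X) = -X
  J_mul : ∀ (i : Fin 3) (m : M) (X : TangentSpace I m),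
    S.J i m (S.J (i + 1) m X) = S.J (i + 2) m X
  J_isometry : ∀ (i : Fin 3) (m : M) (X Y : TangentSpace I m),
    S.g m (S.J i m X) (S.J i m Y) = S.g m X Y

variable {S : HyperkahlerData I M}

theorem IsHyperkahler.isAlmostHyperhermitian (hS : S.IsHyperkahler) :
    S.IsAlmostHyperhermitian :=
  ⟨hS.metric_smooth, hS.metric_symm, hS.metric_pos, hS.J_smooth, hS.J_sq, hS.J_mul, hS.J_isometry⟩

namespace IsAlmostHyperhermitian

variable (hS : S.IsAlmostHyperhermitian)
include hS

theorem g_J_left (i : Fin 3) (m : M) (X Y : TangentSpace I m) :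
    S.g m (S.J i m X) Y = - S.g m X (S.J i m Y) := by
  rw [← hS.J_isometry i m X, hS.J_sq, map_neg, neg_neg]

theorem J_succ_J (i : Fin 3) (m : M) (X : TangentSpace I m) :
    S.J (i + 1) m (S.J i m X) = - S.J (i + 2) m X := by
  have h := hS.J_mul (i + 1) m X
  have e : i + 1 + 2 = i := by rw [add_assoc]; exact add_zero i
  rw [e, add_assoc] at h
  rw [← h]
  exact hS.J_sq _ m _

theorem J_J_add_two (i : Fin 3) (m : M) (X : TangentSpace I m) :
    S.J i m (S.J (i + 2) m X) = - S.J (i + 1) m X := by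
  rw [← hS.J_mul, hS.J_sq]

theorem J_add_two_J (i : Fin 3) (m : M) (X : TangentSpace I m) :
    S.J (i + 2) m (S.J i m X) = S.J (i + 1) m X := by
  have h := hS.J_mul (i + 2) m X
  have e : i + 2 + 1 = i := by rw [add_assoc]; exact add_zero i
  have e' : i + 2 + 2 = i + 1 := by rw [add_assoc]; rfl
  rwa [e, e'] at h

theorem kahlerForm_swap (i : Fin 3) (m : M) (X Y : TangentSpace I m) :
    S.kahlerForm i m X Y = - S.kahlerForm i m Y X := by
  unfold kahlerForm
  rw [hS.g_J_left, hS.metric_symm]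

theorem kahlerForm_self (i : Fin 3) (m : M) (X : TangentSpace I m) :
    S.kahlerForm i m X X = 0 := by
  have := hS.kahlerForm_swap i m X X
  linarith

/-- The Kähler forms are nondegenerate. -/
theorem eq_zero_of_kahlerForm (i : Fin 3) (m : M) {X : TangentSpace I m}
    (h : ∀ Y, S.kahlerForm i m X Y = 0) : X = 0 := by
  by_contra hX
  have := hS.metric_pos m X hX
  rw [← hS.J_isometry i] at this
  exact this.ne' (h _)

theorem kahlerForm_succ_J_left (i : Fin 3) (m : M) (X Y : TangentSpace I m) :
    S.kahlerForm (i + 1) m (S.J i m X) Y = - S.kahlerForm (i + 2) m X Y := by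
  unfold kahlerForm
  rw [hS.J_succ_J, map_neg]
  rfl

theorem kahlerForm_add_two_J_left (i : Fin 3) (m : M) (X Y : TangentSpace I m) :
    S.kahlerForm (i + 2) m (S.J i m X) Y = S.kahlerForm (i + 1) m X Y := by
  unfold kahlerForm
  rw [hS.J_add_two_J]

theorem kahlerForm_succ_J_right (i : Fin 3) (m : M) (X Y : TangentSpace I m) :
    S.kahlerForm (i + 1) m X (S.J i m Y) = - S.kahlerForm (i + 2) m X Y := by
  rw [hS.kahlerForm_swap, hS.kahlerForm_succ_J_left, neg_neg, hS.kahlerForm_swap]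

theorem kahlerForm_add_two_J_right (i : Fin 3) (m : M) (X Y : TangentSpace I m) :
    S.kahlerForm (i + 2) m X (S.J i m Y) = S.kahlerForm (i + 1) m X Y := by
  rw [hS.kahlerForm_swap, hS.kahlerForm_add_two_J_left, ← hS.kahlerForm_swap]

theorem isSmoothVectorField_J (i : Fin 3) {X : ∀ m : M, TangentSpace I m}
    (hX : IsSmoothVectorField X) : IsSmoothVectorField (fun p => S.J i p (X p)) :=
  (hS.J_smooth i).clm_bundle_apply hX

theorem contMDiffAt_g {m : M} {X Y : ∀ m : M, TangentSpace I m}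
    (hX : ContMDiffAt I I.tangent ∞ (fun p => (⟨p, X p⟩ : TangentBundle I M)) m)
    (hY : ContMDiffAt I I.tangent ∞ (fun p => (⟨p, Y p⟩ : TangentBundle I M)) m) :
    ContMDiffAt I 𝓘(ℝ, ℝ) ∞ (fun p => S.g p (X p) (Y p)) m := by
  have h := ((hS.metric_smooth m).clm_bundle_apply (F₂ := E →L[ℝ] ℝ)
    (E₂ := fun m : M => TangentSpace I m →L[ℝ] ℝ) hX).clm_bundle_apply (F₂ := ℝ)
    (E₂ := Bundle.Trivial M ℝ) hY
  exact (Bundle.contMDiffAt_totalSpace.1 h).2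

theorem mdifferentiableAt_g {m : M} {X Y : ∀ m : M, TangentSpace I m}
    (hX : MDifferentiableAt I I.tangent (fun p => (⟨p, X p⟩ : TangentBundle I M)) m)
    (hY : MDifferentiableAt I I.tangent (fun p => (⟨p, Y p⟩ : TangentBundle I M)) m) :
    MDifferentiableAt I 𝓘(ℝ, ℝ) (fun p => S.g p (X p) (Y p)) m := by
  have h := ((hS.metric_smooth.mdifferentiable (by simp) m).clm_bundle_apply (F₂ := E →L[ℝ] ℝ)
    (E₂ := fun m : M => TangentSpace I m →L[ℝ] ℝ) hX).clm_bundle_apply (F₂ := ℝ)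
    (E₂ := Bundle.Trivial M ℝ) hY
  exact ((mdifferentiableAt_totalSpace ..).1 h).2

theorem mdifferentiableAt_kahlerForm (i : Fin 3) {m : M} {X Y : ∀ m : M, TangentSpace I m}
    (hX : MDifferentiableAt I I.tangent (fun p => (⟨p, X p⟩ : TangentBundle I M)) m)
    (hY : MDifferentiableAt I I.tangent (fun p => (⟨p, Y p⟩ : TangentBundle I M)) m) :
    MDifferentiableAt I 𝓘(ℝ, ℝ) (fun p => S.kahlerForm i p (X p) (Y p)) m :=
  hS.mdifferentiableAt_g
    (((hS.J_smooth i).mdifferentiable (by simp) m).clm_bundle_apply hX) hY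

/-- The Nijenhuis tensor of `I_i` in terms of the exterior derivatives of the two other Kähler
forms; all terms without a bracket cancel because `ω_{i+1}(I_i X, Y) = - ω_{i+2}(X, Y)` and
`ω_{i+2}(I_i X, Y) = ω_{i+1}(X, Y)`. -/
theorem kahlerForm_nijenhuis (i : Fin 3) (X Y Z : ∀ m : M, TangentSpace I m) (m : M) :
    S.kahlerForm (i + 1) m (S.nijenhuis i X Y m) (Z m) =
      S.dKahlerForm (i + 1) X Y Z m
      - S.dKahlerForm (i + 1) (fun p => S.J i p (X p)) (fun p => S.J i p (Y p)) Z m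
      - S.dKahlerForm (i + 2) (fun p => S.J i p (X p)) Y Z m
      - S.dKahlerForm (i + 2) X (fun p => S.J i p (Y p)) Z m := by
  have hN : S.kahlerForm (i + 1) m (S.nijenhuis i X Y m) (Z m) =
      S.kahlerForm (i + 1) m (VectorField.mlieBracket I (fun p => S.J i p (X p))
        (fun p => S.J i p (Y p)) m) (Z m)
      + S.kahlerForm (i + 2) m (VectorField.mlieBracket I (fun p => S.J i p (X p)) Y m) (Z m)
      + S.kahlerForm (i + 2) m (VectorField.mlieBracket I X (fun p => S.J i p (Y p)) m) (Z m)
      - S.kahlerForm (i + 1) m (VectorField.mlieBracket I X Y m) (Z m) := by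
    have h1 := hS.kahlerForm_succ_J_left i m
      (VectorField.mlieBracket I (fun p => S.J i p (X p)) Y m) (Z m)
    have h2 := hS.kahlerForm_succ_J_left i m
      (VectorField.mlieBracket I X (fun p => S.J i p (Y p)) m) (Z m)
    unfold kahlerForm nijenhuis at *
    simp only [map_sub, sub_apply]
    linarith
  rw [hN]
  unfold dKahlerForm
  simp only [hS.kahlerForm_succ_J_left, hS.kahlerForm_add_two_J_left, hS.kahlerForm_succ_J_right,
    hS.kahlerForm_add_two_J_right, mvfderiv_fun_neg, neg_apply]
  ring

/-- For an almost hyperhermitian structure, closed Kähler forms force the almost complex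
structures to be integrable. -/
theorem isHyperkahler [FiniteDimensional ℝ E] [T2Space M]
    (hclosed : ∀ (i : Fin 3) (X Y Z : ∀ m : M, TangentSpace I m),
      IsSmoothVectorField X → IsSmoothVectorField Y → IsSmoothVectorField Z →
        ∀ m, S.dKahlerForm i X Y Z m = 0) : S.IsHyperkahler where
  metric_smooth := hS.metric_smooth
  metric_symm := hS.metric_symm
  metric_pos := hS.metric_pos
  J_smooth := hS.J_smooth
  J_sq := hS.J_sq
  J_mul := hS.J_mul
  J_isometry := hS.J_isometry
  kahlerForm_closed := hclosed
  J_integrable i X Y hX hY m := by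
    -- by nondegeneracy of `ω_{i+1}`, it suffices to pair the Nijenhuis tensor with all vectors
    refine hS.eq_zero_of_kahlerForm (i + 1) m fun v => ?_
    obtain ⟨Z, hZ, rfl⟩ := exists_isSmoothVectorField_eq m v
    have hJX := hS.isSmoothVectorField_J i hX
    have hJY := hS.isSmoothVectorField_J i hY
    rw [hS.kahlerForm_nijenhuis, hclosed _ X Y Z hX hY hZ, hclosed _ _ _ Z hJX hJY hZ,
      hclosed _ _ Y Z hJX hY hZ, hclosed _ X _ Z hX hJY hZ]
    simp

end IsAlmostHyperhermitian

end HyperkahlerData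

/-! ### Tensoriality of the exterior derivative of a Kähler form -/

namespace HyperkahlerData

variable {E : Type*} [NormedAddCommGroup E] [NormedSpace ℝ E]
  {H : Type*} [TopologicalSpace H] {I : ModelWithCorners ℝ E H}
  {M : Type*} [TopologicalSpace M] [ChartedSpace H M] [IsManifold I ∞ M]
  {S : HyperkahlerData I M}

namespace IsAlmostHyperhermitian

variable (hS : S.IsAlmostHyperhermitian)
include hS

theorem dKahlerForm_swap_left (i : Fin 3) (X Y Z : ∀ m : M, TangentSpace I m) (m : M) :
    S.dKahlerForm i X Y Z m = - S.dKahlerForm i Y X Z m := by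
  unfold dKahlerForm
  have e : (fun p => S.kahlerForm i p (Y p) (X p)) = fun p => - S.kahlerForm i p (X p) (Y p) :=
    funext fun p => hS.kahlerForm_swap i p _ _
  rw [e, mvfderiv_fun_neg, VectorField.mlieBracket_swap_apply (V := Y) (W := X)]
  have h : S.kahlerForm i m (-VectorField.mlieBracket I X Y m) (Z m) =
      - S.kahlerForm i m (VectorField.mlieBracket I X Y m) (Z m) := by simp [kahlerForm]
  rw [h, neg_apply]
  ring

theorem dKahlerForm_swap_right (i : Fin 3) (X Y Z : ∀ m : M, TangentSpace I m) (m : M) :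
    S.dKahlerForm i X Y Z m = - S.dKahlerForm i X Z Y m := by
  unfold dKahlerForm
  have e : (fun p => S.kahlerForm i p (Z p) (Y p)) = fun p => - S.kahlerForm i p (Y p) (Z p) :=
    funext fun p => hS.kahlerForm_swap i p _ _
  rw [e, mvfderiv_fun_neg, VectorField.mlieBracket_swap_apply (V := Z) (W := Y)]
  have h : S.kahlerForm i m (-VectorField.mlieBracket I Y Z m) (X m) =
      - S.kahlerForm i m (VectorField.mlieBracket I Y Z m) (X m) := by simp [kahlerForm]
  rw [h, neg_apply]
  ring

/-- The exterior derivative of a Kähler form is tensorial in its first argument. -/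
theorem tensorialAt_dKahlerForm [FiniteDimensional ℝ E] (i : Fin 3) {m : M}
    {Y Z : ∀ m : M, TangentSpace I m}
    (hY : MDifferentiableAt I I.tangent (fun p => (⟨p, Y p⟩ : TangentBundle I M)) m)
    (hZ : MDifferentiableAt I I.tangent (fun p => (⟨p, Z p⟩ : TangentBundle I M)) m) :
    TensorialAt I E (fun X : ∀ m : M, TangentSpace I m => S.dKahlerForm i X Y Z m) m where
  smul {f X} hf hX := by
    have : IsManifold I 2 M := .of_le (n := ∞) ENat.LEInfty.out
    have h1 : ∀ W : ∀ m : M, TangentSpace I m, (fun p => S.kahlerForm i p ((f • X) p) (W p)) =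
        fun p => f p * S.kahlerForm i p (X p) (W p) := fun W => by
      funext p
      simp [kahlerForm]
    unfold dKahlerForm
    rw [h1, h1, mvfderiv_fun_mul hf (hS.mdifferentiableAt_kahlerForm i hX hZ),
      mvfderiv_fun_mul hf (hS.mdifferentiableAt_kahlerForm i hX hY),
      VectorField.mlieBracket_smul_left hf hX, VectorField.mlieBracket_smul_left hf hX]
    simp only [kahlerForm, Pi.smul_apply', map_add, map_smul, map_neg, add_apply, smul_apply,
      neg_apply, smul_eq_mul, neg_smul]
    ring
  add {X X'} hX hX' := by
    have : IsManifold I 2 M := .of_le (n := ∞) ENat.LEInfty.out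
    have h1 : ∀ W : ∀ m : M, TangentSpace I m, (fun p => S.kahlerForm i p ((X + X') p) (W p)) =
        fun p => S.kahlerForm i p (X p) (W p) + S.kahlerForm i p (X' p) (W p) := fun W => by
      funext p
      simp [kahlerForm]
    unfold dKahlerForm
    rw [h1, h1, mvfderiv_fun_add (hS.mdifferentiableAt_kahlerForm i hX hZ)
      (hS.mdifferentiableAt_kahlerForm i hX' hZ),
      mvfderiv_fun_add (hS.mdifferentiableAt_kahlerForm i hX hY)
      (hS.mdifferentiableAt_kahlerForm i hX' hY),
      VectorField.mlieBracket_add_left hX hX', VectorField.mlieBracket_add_left hX hX']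
    simp only [kahlerForm, Pi.add_apply, map_add, add_apply]
    ring

/-- The value of `dω_i(X, Y, Z)` at `m` depends only on the values of `X`, `Y`, `Z` at `m`. -/
theorem dKahlerForm_congr [FiniteDimensional ℝ E] (i : Fin 3) {m : M}
    {X Y Z X' Y' Z' : ∀ m : M, TangentSpace I m}
    (hX : MDifferentiableAt I I.tangent (fun p => (⟨p, X p⟩ : TangentBundle I M)) m)
    (hY : MDifferentiableAt I I.tangent (fun p => (⟨p, Y p⟩ : TangentBundle I M)) m)
    (hZ : MDifferentiableAt I I.tangent (fun p => (⟨p, Z p⟩ : TangentBundle I M)) m)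
    (hX' : MDifferentiableAt I I.tangent (fun p => (⟨p, X' p⟩ : TangentBundle I M)) m)
    (hY' : MDifferentiableAt I I.tangent (fun p => (⟨p, Y' p⟩ : TangentBundle I M)) m)
    (hZ' : MDifferentiableAt I I.tangent (fun p => (⟨p, Z' p⟩ : TangentBundle I M)) m)
    (eX : X m = X' m) (eY : Y m = Y' m) (eZ : Z m = Z' m) :
    S.dKahlerForm i X Y Z m = S.dKahlerForm i X' Y' Z' m := by
  have : IsManifold I 1 M := .of_le (n := ∞) (by simp)
  have h1 := (hS.tensorialAt_dKahlerForm i hY hZ).pointwise hX hX' eX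
  have h2 := (hS.tensorialAt_dKahlerForm i hX' hZ).pointwise hY hY' eY
  have h3 := (hS.tensorialAt_dKahlerForm i hX' hY').pointwise hZ hZ' eZ
  rw [h1, hS.dKahlerForm_swap_left, h2, hS.dKahlerForm_swap_left, neg_neg,
    hS.dKahlerForm_swap_right, hS.dKahlerForm_swap_left, neg_neg, h3,
    hS.dKahlerForm_swap_left, hS.dKahlerForm_swap_right, neg_neg]

end IsAlmostHyperhermitian

end HyperkahlerData

/-! ### Vector fields on a product with a vector space -/

section Product

variable {E : Type*} [NormedAddCommGroup E] [NormedSpace ℝ E]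
  {H : Type*} [TopologicalSpace H] {I : ModelWithCorners ℝ E H}
  {M : Type*} [TopologicalSpace M] [ChartedSpace H M] [IsManifold I ∞ M]
  {F : Type*} [NormedAddCommGroup F] [NormedSpace ℝ F]

/-- A vector field on `M × F` is smooth if and only if its two components are smooth. -/
theorem contMDiffAt_prod_vectorField_iff {n : WithTop ℕ∞} {p₀ : M × F}
    {σ : ∀ p : M × F, TangentSpace (I.prod 𝓘(ℝ, F)) p} :
    ContMDiffAt (I.prod 𝓘(ℝ, F)) (I.prod 𝓘(ℝ, F)).tangent n
      (fun p => (⟨p, σ p⟩ : TangentBundle (I.prod 𝓘(ℝ, F)) (M × F))) p₀ ↔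
    ContMDiffAt (I.prod 𝓘(ℝ, F)) I.tangent n
      (fun p => (⟨p.1, (σ p).1⟩ : TangentBundle I M)) p₀ ∧
    ContMDiffAt (I.prod 𝓘(ℝ, F)) 𝓘(ℝ, F) n (fun p => ((σ p).2 : F)) p₀ := by
  have : IsManifold I 1 M := .of_le (n := ∞) (by simp)
  constructor
  · intro h
    have h1 := (contMDiff_equivTangentBundleProd (n := n) (I := I) (I' := 𝓘(ℝ, F)) (M := M)
      (M' := F)).contMDiffAt.comp p₀ h
    refine ⟨contMDiffAt_fst.comp p₀ h1, ?_⟩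
    exact (contMDiff_snd_tangentBundle_modelSpace F 𝓘(ℝ, F)).contMDiffAt.comp p₀
      (contMDiffAt_snd.comp p₀ h1)
  · rintro ⟨h1, h2⟩
    have h3 : ContMDiffAt (I.prod 𝓘(ℝ, F)) 𝓘(ℝ, F).tangent n
        (fun p : M × F => (⟨p.2, (σ p).2⟩ : TangentBundle 𝓘(ℝ, F) F)) p₀ := by
      refine Bundle.contMDiffAt_totalSpace.2 ⟨contMDiffAt_snd, ?_⟩
      simpa using! h2
    exact (contMDiff_equivTangentBundleProd_symm (n := n) (I := I) (I' := 𝓘(ℝ, F)) (M := M)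
      (M' := F)).contMDiffAt.comp p₀ (h1.prodMk h3)

omit [IsManifold I ∞ M] in
/-- No differentiability of `g` is needed: `g` and `p ↦ g p.1` are differentiable simultaneously. -/
theorem mvfderiv_comp_fst {G : Type*} [NormedAddCommGroup G] [NormedSpace ℝ G] (g : M → G)
    (p : M × F) (v : TangentSpace (I.prod 𝓘(ℝ, F)) p) :
    mvfderiv (I.prod 𝓘(ℝ, F)) (fun p : M × F => g p.1) p v = mvfderiv I g p.1 v.1 := by
  by_cases hg : MDifferentiableAt I 𝓘(ℝ, G) g p.1
  · have h := (hg.hasMFDerivAt.comp p (hasMFDerivAt_fst (I := I) (I' := 𝓘(ℝ, F)) p)).mfderiv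
    exact congrArg (fun L : E × F →L[ℝ] G => L v) h
  · have hg' : ¬ MDifferentiableAt (I.prod 𝓘(ℝ, F)) 𝓘(ℝ, G) (fun p : M × F => g p.1) p := by
      intro h
      refine hg ?_
      have h' : MDifferentiableAt I (I.prod 𝓘(ℝ, F)) (fun q : M => (q, p.2)) p.1 :=
        mdifferentiableAt_id.prodMk mdifferentiableAt_const
      exact MDifferentiableAt.comp (g := fun p : M × F => g p.1) p.1 h h'
    unfold mvfderiv
    rw [mfderiv_zero_of_not_mdifferentiableAt hg, mfderiv_zero_of_not_mdifferentiableAt hg']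
    rfl

/-- The bracket of two fields on `M × F`, each the sum of a field on `M` and a constant field
on `F`. -/
theorem mlieBracket_prod_const [FiniteDimensional ℝ E] [FiniteDimensional ℝ F] [I.Boundaryless]
    {X Y : ∀ m : M, TangentSpace I m} (hX : IsSmoothVectorField X) (hY : IsSmoothVectorField Y)
    (v w : F) (p : M × F) :
    (VectorField.mlieBracket (I.prod 𝓘(ℝ, F)) (fun p => ((X p.1, v) : E × F))
      (fun p => ((Y p.1, w) : E × F)) p : E × F) = (VectorField.mlieBracket I X Y p.1, 0) := by
  have : IsManifold I 1 M := .of_le (n := ∞) (by simp)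
  have : CompleteSpace (E × F) := FiniteDimensional.complete ℝ _
  have : CompleteSpace E := FiniteDimensional.complete ℝ _
  have hs : ∀ {Z : ∀ m : M, TangentSpace I m} (u : F), IsSmoothVectorField Z →
      MDifferentiableAt (I.prod 𝓘(ℝ, F)) (I.prod 𝓘(ℝ, F)).tangent
        (fun q => (⟨q, ((Z q.1, u) : E × F)⟩ : TangentBundle (I.prod 𝓘(ℝ, F)) (M × F))) p :=
    fun {Z} u hZ => (contMDiffAt_prod_vectorField_iff (n := ∞) (σ := fun q => ((Z q.1, u) : E × F))
      |>.2 ⟨hZ.contMDiffAt.comp p contMDiffAt_fst, contMDiffAt_const⟩).mdifferentiableAt (by simp)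
  set e := extChartAt I p.1 with he
  have hes : ContMDiffAt I 𝓘(ℝ, E) 2 e p.1 := contMDiffAt_extChartAt.of_le ENat.LEInfty.out
  have h1 := mvfderiv_mlieBracket (m := p) (hes.comp p (contMDiffAt_fst (J := 𝓘(ℝ, F)) (N := F)))
    (hs v hX) (hs w hY)
  have h2 := mvfderiv_mlieBracket (I := I.prod 𝓘(ℝ, F)) (m := p) (f := Prod.snd)
    (contMDiffAt_snd (n := 2) (J := 𝓘(ℝ, F)) (N := F)) (hs v hX) (hs w hY)
  have h3 := mvfderiv_mlieBracket (m := p.1) hes (hX.mdifferentiable (by simp) _)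
    (hY.mdifferentiable (by simp) _)
  have hid : (mvfderiv I e p.1 : E →L[ℝ] E) = ContinuousLinearMap.id ℝ E := mfderiv_extChartAt_self
  -- the components of the bracket are its derivatives of a chart of `M` and of the projection to `F`
  refine Prod.ext ?_ ?_
  · have hc : ∀ {Z : ∀ m : M, TangentSpace I m} (u : F),
        (fun q => mvfderiv (I.prod 𝓘(ℝ, F)) (e ∘ (Prod.fst : M × F → M)) q ((Z q.1, u) : E × F)) =
          fun q => mvfderiv I e q.1 (Z q.1) := fun u => funext fun q => mvfderiv_comp_fst e q _
    have h4 := (congrArg (fun f => mvfderiv (I.prod 𝓘(ℝ, F)) f p ((X p.1, v) : E × F)) (hc w)).trans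
      (mvfderiv_comp_fst (F := F) (fun m => mvfderiv I e m (Y m)) p ((X p.1, v) : E × F))
    have h5 := (congrArg (fun f => mvfderiv (I.prod 𝓘(ℝ, F)) f p ((Y p.1, w) : E × F)) (hc v)).trans
      (mvfderiv_comp_fst (F := F) (fun m => mvfderiv I e m (X m)) p ((Y p.1, w) : E × F))
    have h6 := (mvfderiv_comp_fst e p _).symm.trans
      (h1.trans ((congrArg₂ (· - ·) h4 h5).trans h3.symm))
    exact (congrArg (fun L : E →L[ℝ] E => L _) hid).symm.trans
      (h6.trans (congrArg (fun L : E →L[ℝ] E => L _) hid))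
  · have hsnd : ∀ (q : M × F) (u : TangentSpace (I.prod 𝓘(ℝ, F)) q),
        mvfderiv (I.prod 𝓘(ℝ, F)) (Prod.snd : M × F → F) q u = u.2 := fun q u =>
      congrArg (fun L : E × F →L[ℝ] F => L u) (mfderiv_snd (I := I) (I' := 𝓘(ℝ, F)) (x := q))
    have hc : ∀ {Z : ∀ m : M, TangentSpace I m} (u : F) (z : E × F),
        mvfderiv (I.prod 𝓘(ℝ, F)) (fun q => mvfderiv (I.prod 𝓘(ℝ, F)) (Prod.snd : M × F → F) q
          ((Z q.1, u) : E × F)) p z = 0 := fun {Z} u z => by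
      have : (fun q => mvfderiv (I.prod 𝓘(ℝ, F)) (Prod.snd : M × F → F) q
          ((Z q.1, u) : E × F)) = fun _ => u := funext fun q => hsnd q _
      rw [this, mvfderiv_const]
      rfl
    refine (hsnd p _).symm.trans (h2.trans ?_)
    exact (congrArg₂ (· - ·) (hc w _) (hc v _)).trans (sub_zero _)

end Product

/-! ### The product with the quaternions -/

theorem quaternion_inner_eq (p q : ℍ[ℝ]) :
    inner ℝ p q = p.re * q.re + p.imI * q.imI + p.imJ * q.imJ + p.imK * q.imK := by
  rw [Quaternion.inner_def]
  simp

theorem quaternionUnit_mul_self (i : Fin 3) : quaternionUnit i * quaternionUnit i = -1 := by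
  ext <;> simp only [Quaternion.re_mul, Quaternion.imI_mul, Quaternion.imJ_mul, Quaternion.imK_mul] <;>
    fin_cases i <;> simp [quaternionUnit]

theorem quaternionUnit_mul_succ (i : Fin 3) :
    quaternionUnit i * quaternionUnit (i + 1) = quaternionUnit (i + 2) := by
  ext <;> simp only [Quaternion.re_mul, Quaternion.imI_mul, Quaternion.imJ_mul, Quaternion.imK_mul] <;>
    fin_cases i <;> simp [quaternionUnit]

theorem inner_quaternionUnit_mul (i : Fin 3) (p q : ℍ[ℝ]) :
    inner ℝ (quaternionUnit i * p) (quaternionUnit i * q) = inner ℝ p q := by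
  simp only [quaternion_inner_eq, Quaternion.re_mul, Quaternion.imI_mul, Quaternion.imJ_mul,
    Quaternion.imK_mul]
  fin_cases i <;> simp [quaternionUnit] <;> ring

namespace HyperkahlerData

variable {E : Type*} [NormedAddCommGroup E] [NormedSpace ℝ E]
  {H : Type*} [TopologicalSpace H] {I : ModelWithCorners ℝ E H}
  {M : Type*} [TopologicalSpace M] [ChartedSpace H M] [IsManifold I ∞ M]
  {S : HyperkahlerData I M}

omit [IsManifold I ∞ M] in
theorem prodQuaternion_g_apply (p : M × ℍ[ℝ]) (X Y : TangentSpace (I.prod 𝓘(ℝ, ℍ[ℝ])) p) :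
    S.prodQuaternion.g p X Y = S.g p.1 X.1 Y.1 + inner ℝ (X.2 : ℍ[ℝ]) (Y.2 : ℍ[ℝ]) :=
  rfl

omit [IsManifold I ∞ M] in
theorem prodQuaternion_kahlerForm_apply (i : Fin 3) (p : M × ℍ[ℝ])
    (X Y : TangentSpace (I.prod 𝓘(ℝ, ℍ[ℝ])) p) :
    S.prodQuaternion.kahlerForm i p X Y =
      S.kahlerForm i p.1 X.1 Y.1 + inner ℝ (quaternionUnit i * (X.2 : ℍ[ℝ])) (Y.2 : ℍ[ℝ]) :=
  rfl

namespace IsAlmostHyperhermitian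

variable (hS : S.IsAlmostHyperhermitian)
include hS

theorem prodQuaternion [FiniteDimensional ℝ E] : S.prodQuaternion.IsAlmostHyperhermitian where
  metric_smooth p := by
    refine contMDiffAt_hom_section fun σ hσ => contMDiffAt_hom_section
      (V₂ := Bundle.Trivial (M × ℍ[ℝ]) ℝ) fun τ hτ => Bundle.contMDiffAt_totalSpace.2
      ⟨contMDiffAt_id, ?_⟩
    obtain ⟨h1, h2⟩ := contMDiffAt_prod_vectorField_iff.1 hσ
    obtain ⟨k1, k2⟩ := contMDiffAt_prod_vectorField_iff.1 hτ
    have h := (((hS.metric_smooth p.1).comp p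
      (contMDiffAt_fst (J := 𝓘(ℝ, ℍ[ℝ])))).clm_bundle_apply (F₂ := E →L[ℝ] ℝ)
      (E₂ := fun m : M => TangentSpace I m →L[ℝ] ℝ) (b := Prod.fst) h1).clm_bundle_apply (F₂ := ℝ)
      (E₂ := Bundle.Trivial M ℝ) (b := Prod.fst) k1
    have h' := (Bundle.contMDiffAt_totalSpace.1 h).2
    refine h'.add ?_
    exact (isBoundedBilinearMap_inner (𝕜 := ℝ) (E := ℍ[ℝ])).contDiff.contMDiff.contMDiffAt.comp p
      (h2.prodMk_space k2)
  metric_symm p X Y := by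
    rw [prodQuaternion_g_apply, prodQuaternion_g_apply]
    exact congrArg₂ (· + ·) (hS.metric_symm p.1 X.1 Y.1) (real_inner_comm _ _)
  metric_pos p X hX := by
    rw [prodQuaternion_g_apply]
    have h0 : ∀ v : TangentSpace I p.1, 0 ≤ S.g p.1 v v := fun v => by
      by_cases hv : v = 0
      · simp [hv]
      · exact (hS.metric_pos _ _ hv).le
    by_cases h1 : X.1 = 0
    · have h2 : (X.2 : ℍ[ℝ]) ≠ 0 := fun h2 => hX (Prod.ext h1 h2)
      exact add_pos_of_nonneg_of_pos (h0 _) (real_inner_self_pos.2 h2)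
    · exact add_pos_of_pos_of_nonneg (hS.metric_pos _ _ h1) real_inner_self_nonneg
  J_smooth i p := by
    refine contMDiffAt_hom_section fun σ hσ => ?_
    obtain ⟨h1, h2⟩ := contMDiffAt_prod_vectorField_iff.1 hσ
    refine contMDiffAt_prod_vectorField_iff.2 ⟨?_, ?_⟩
    · exact ((hS.J_smooth i p.1).comp p
        (contMDiffAt_fst (J := 𝓘(ℝ, ℍ[ℝ])))).clm_bundle_apply (b := Prod.fst) h1
    · exact (ContinuousLinearMap.mul ℝ ℍ[ℝ] (quaternionUnit i)).contMDiff.contMDiffAt.comp p h2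
  J_sq i p X := by
    refine Prod.ext (hS.J_sq i p.1 X.1) ?_
    change quaternionUnit i * (quaternionUnit i * (X.2 : ℍ[ℝ])) = - (X.2 : ℍ[ℝ])
    rw [← mul_assoc, quaternionUnit_mul_self, neg_one_mul]
  J_mul i p X := by
    refine Prod.ext (hS.J_mul i p.1 X.1) ?_
    change quaternionUnit i * (quaternionUnit (i + 1) * (X.2 : ℍ[ℝ])) =
      quaternionUnit (i + 2) * (X.2 : ℍ[ℝ])
    rw [← mul_assoc, quaternionUnit_mul_succ]
  J_isometry i p X Y := by
    rw [prodQuaternion_g_apply, prodQuaternion_g_apply]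
    exact congrArg₂ (· + ·) (hS.J_isometry i p.1 X.1 Y.1) (inner_quaternionUnit_mul i X.2 Y.2)

end IsAlmostHyperhermitian

/-- The product with the quaternions is hyperkähler: `dω_i` vanishes on fields which are sums of
a field on `M` and a constant field on `ℍ`, and these take all values at a given point. -/
theorem IsHyperkahler.prodQuaternion [FiniteDimensional ℝ E] [T2Space M] [I.Boundaryless]
    (hS : S.IsHyperkahler) : S.prodQuaternion.IsHyperkahler := by
  have hP := hS.isAlmostHyperhermitian.prodQuaternion
  refine hP.isHyperkahler fun i X Y Z hX hY hZ p => ?_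
  obtain ⟨X₁, hX₁, eX⟩ := exists_isSmoothVectorField_eq (I := I) p.1 (X p).1
  obtain ⟨Y₁, hY₁, eY⟩ := exists_isSmoothVectorField_eq (I := I) p.1 (Y p).1
  obtain ⟨Z₁, hZ₁, eZ⟩ := exists_isSmoothVectorField_eq (I := I) p.1 (Z p).1
  have hs : ∀ {Z : ∀ m : M, TangentSpace I m} (u : ℍ[ℝ]), IsSmoothVectorField Z →
      MDifferentiableAt (I.prod 𝓘(ℝ, ℍ[ℝ])) (I.prod 𝓘(ℝ, ℍ[ℝ])).tangent
        (fun q => (⟨q, ((Z q.1, u) : E × ℍ[ℝ])⟩ :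
          TangentBundle (I.prod 𝓘(ℝ, ℍ[ℝ])) (M × ℍ[ℝ]))) p := fun {Z} u hZ =>
    (contMDiffAt_prod_vectorField_iff (n := ∞) (σ := fun q => ((Z q.1, u) : E × ℍ[ℝ])) |>.2
      ⟨hZ.contMDiffAt.comp p contMDiffAt_fst, contMDiffAt_const⟩).mdifferentiableAt (by simp)
  have hcongr := hP.dKahlerForm_congr i (X' := fun q => ((X₁ q.1, (X p).2) : E × ℍ[ℝ]))
    (Y' := fun q => ((Y₁ q.1, (Y p).2) : E × ℍ[ℝ])) (Z' := fun q => ((Z₁ q.1, (Z p).2) : E × ℍ[ℝ]))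
    (hX.mdifferentiable (by simp) _) (hY.mdifferentiable (by simp) _)
    (hZ.mdifferentiable (by simp) _) (hs (X p).2 hX₁) (hs (Y p).2 hY₁) (hs (Z p).2 hZ₁)
    (Prod.ext eX.symm rfl) (Prod.ext eY.symm rfl) (Prod.ext eZ.symm rfl)
  refine hcongr.trans ?_
  -- the `ℍ`-part of `ω_i` is constant on constant fields
  have hder : ∀ {U W : ∀ m : M, TangentSpace I m}, IsSmoothVectorField U → IsSmoothVectorField W →
      ∀ (u w : ℍ[ℝ]) (v : E × ℍ[ℝ]),
      mvfderiv (I.prod 𝓘(ℝ, ℍ[ℝ])) (fun q => S.prodQuaternion.kahlerForm i q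
        ((U q.1, u) : E × ℍ[ℝ]) ((W q.1, w) : E × ℍ[ℝ])) p v =
      mvfderiv I (fun m => S.kahlerForm i m (U m) (W m)) p.1 v.1 := by
    intro U W hU hW u w v
    refine (mvfderiv_comp_fst (fun m => S.kahlerForm i m (U m) (W m) +
      inner ℝ (quaternionUnit i * u) w) p v).trans ?_
    rw [mvfderiv_fun_add (hS.isAlmostHyperhermitian.mdifferentiableAt_kahlerForm i
      (hU.mdifferentiable (by simp) _) (hW.mdifferentiable (by simp) _)) mdifferentiableAt_const,
      mvfderiv_const, add_zero]
  -- brackets of these fields have no `ℍ`-part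
  have hbr : ∀ {U W : ∀ m : M, TangentSpace I m}, IsSmoothVectorField U → IsSmoothVectorField W →
      ∀ (u w : ℍ[ℝ]) (v : E × ℍ[ℝ]),
      S.prodQuaternion.kahlerForm i p (VectorField.mlieBracket (I.prod 𝓘(ℝ, ℍ[ℝ]))
        (fun q => ((U q.1, u) : E × ℍ[ℝ])) (fun q => ((W q.1, w) : E × ℍ[ℝ])) p) v =
      S.kahlerForm i p.1 (VectorField.mlieBracket I U W p.1) v.1 := by
    intro U W hU hW u w v
    refine (congrArg (fun z : E × ℍ[ℝ] => S.prodQuaternion.kahlerForm i p z v)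
      (mlieBracket_prod_const hU hW u w p)).trans ?_
    refine (prodQuaternion_kahlerForm_apply i p _ _).trans ?_
    change S.kahlerForm i p.1 (VectorField.mlieBracket I U W p.1) v.1 +
      inner ℝ (quaternionUnit i * 0) v.2 = _
    rw [mul_zero, inner_zero_left, add_zero]
  have h0 := hS.kahlerForm_closed i X₁ Y₁ Z₁ hX₁ hY₁ hZ₁ p.1
  unfold dKahlerForm at h0 ⊢
  linear_combination h0 + hder hY₁ hZ₁ (Y p).2 (Z p).2 (X₁ p.1, (X p).2)
    - hder hX₁ hZ₁ (X p).2 (Z p).2 (Y₁ p.1, (Y p).2)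
    + hder hX₁ hY₁ (X p).2 (Y p).2 (Z₁ p.1, (Z p).2)
    - hbr hX₁ hY₁ (X p).2 (Y p).2 (Z₁ p.1, (Z p).2)
    + hbr hX₁ hZ₁ (X p).2 (Z p).2 (Y₁ p.1, (Y p).2)
    - hbr hY₁ hZ₁ (Y p).2 (Z p).2 (X₁ p.1, (X p).2)

end HyperkahlerData

/-! ### The modified structure -/

/-- A sum over the three indices, arranged along the cyclic permutation beginning with `i`. -/
theorem sum_fin_three_cyclic (f : Fin 3 → ℝ) (i : Fin 3) :
    ∑ l, f l = f i + f (i + 1) + f (i + 2) := by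
  rw [Fin.sum_univ_three]
  fin_cases i <;> simp <;> ring

namespace HyperkahlerData

variable {E : Type*} [NormedAddCommGroup E] [NormedSpace ℝ E]
  {H : Type*} [TopologicalSpace H] {I : ModelWithCorners ℝ E H}
  {M : Type*} [TopologicalSpace M] [ChartedSpace H M]

/-- The coefficient `a² / (1 + a² g(T, T))`, equal to `a² V / (a² + V)` where `T ≠ 0`. -/
def taubNUTCoeff (S : HyperkahlerData I M) (T : ∀ m : M, TangentSpace I m) (a : ℝ) (m : M) : ℝ :=
  a ^ 2 / (1 + a ^ 2 * S.g m (T m) (T m))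

/-- The Taub-NUT modification of a hyperkähler structure along a vector field `T`. With
`θ = g(T, ·)`, `α_i = g(I_i T, ·)` and `s = a² / (1 + a² g(T, T))`, the metric is
`g + a² ∑ α_i² - s θ²` and the complex structures are `I_i - s θ ⊗ I_i T - a² α_i ⊗ T`. These
expressions make sense at the zeros of `T` too. -/
def taubNUT (S : HyperkahlerData I M) (T : ∀ m : M, TangentSpace I m) (a : ℝ) :
    HyperkahlerData I M where
  g m := S.g m + a ^ 2 • ∑ i : Fin 3,
      (S.g m (S.J i m (T m))).smulRight (S.g m (S.J i m (T m)))
    - S.taubNUTCoeff T a m • (S.g m (T m)).smulRight (S.g m (T m))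
  J i m := S.J i m - S.taubNUTCoeff T a m • (S.g m (T m)).smulRight (S.J i m (T m))
    - a ^ 2 • (S.g m (S.J i m (T m))).smulRight (T m)

variable {S : HyperkahlerData I M} {T : ∀ m : M, TangentSpace I m} {a : ℝ}

theorem taubNUT_g_apply (m : M) (X Y : TangentSpace I m) :
    (S.taubNUT T a).g m X Y = S.g m X Y
      + a ^ 2 * ∑ i : Fin 3, S.g m (S.J i m (T m)) X * S.g m (S.J i m (T m)) Y
      - S.taubNUTCoeff T a m * (S.g m (T m) X * S.g m (T m) Y) := by
  simp [taubNUT, sub_apply, add_apply, smul_apply]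

theorem taubNUT_J_apply (i : Fin 3) (m : M) (X : TangentSpace I m) :
    (S.taubNUT T a).J i m X = S.J i m X
      - (S.taubNUTCoeff T a m * S.g m (T m) X) • S.J i m (T m)
      - (a ^ 2 * S.g m (S.J i m (T m)) X) • T m := by
  simp [taubNUT, mul_smul]

variable [IsManifold I ∞ M]

namespace IsAlmostHyperhermitian

variable (hS : S.IsAlmostHyperhermitian)
include hS

theorem g_self_nonneg (m : M) (X : TangentSpace I m) : 0 ≤ S.g m X X := by
  by_cases hX : X = 0
  · simp [hX]
  · exact (hS.metric_pos m X hX).le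

/-- The Cauchy-Schwarz inequality. -/
theorem g_sq_le (m : M) (X Y : TangentSpace I m) :
    S.g m X Y ^ 2 ≤ S.g m X X * S.g m Y Y := by
  by_cases hX : X = 0
  · simp [hX]
  have hpos := hS.metric_pos m X hX
  have h := hS.g_self_nonneg m (S.g m X X • Y - S.g m X Y • X)
  simp only [map_sub, map_smul, sub_apply, smul_apply, smul_eq_mul, hS.metric_symm m Y X] at h
  refine le_of_mul_le_mul_left ?_ hpos
  linarith

theorem one_add_pos (T : ∀ m : M, TangentSpace I m) (a : ℝ) (m : M) :
    0 < 1 + a ^ 2 * S.g m (T m) (T m) := by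
  have := hS.g_self_nonneg m (T m)
  positivity

/-- The relation `s (1 + a² g(T, T)) = a²`, the only property of `s` used in the algebraic laws. -/
theorem taubNUTCoeff_mul (T : ∀ m : M, TangentSpace I m) (a : ℝ) (m : M) :
    S.taubNUTCoeff T a m * (1 + a ^ 2 * S.g m (T m) (T m)) = a ^ 2 :=
  div_mul_cancel₀ _ (hS.one_add_pos T a m).ne'

theorem g_J_self (i : Fin 3) (m : M) (X : TangentSpace I m) : S.g m (S.J i m X) X = 0 :=
  hS.kahlerForm_self i m X

theorem g_J_self' (i : Fin 3) (m : M) (X : TangentSpace I m) : S.g m X (S.J i m X) = 0 := by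
  rw [hS.metric_symm, hS.g_J_self]

theorem g_J_right (i : Fin 3) (m : M) (X Y : TangentSpace I m) :
    S.g m X (S.J i m Y) = - S.g m (S.J i m X) Y := by
  rw [hS.g_J_left, neg_neg]

theorem g_J_succ_J (i : Fin 3) (m : M) (X Y : TangentSpace I m) :
    S.g m (S.J (i + 1) m X) (S.J i m Y) = - S.g m (S.J (i + 2) m X) Y := by
  rw [hS.g_J_right, hS.J_mul]

theorem g_J_add_two_J (i : Fin 3) (m : M) (X Y : TangentSpace I m) :
    S.g m (S.J (i + 2) m X) (S.J i m Y) = S.g m (S.J (i + 1) m X) Y := by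
  rw [hS.g_J_right, hS.J_J_add_two, map_neg, neg_apply, neg_neg]

theorem g_J_J_succ (i : Fin 3) (m : M) (X Y : TangentSpace I m) :
    S.g m (S.J i m X) (S.J (i + 1) m Y) = S.g m (S.J (i + 2) m X) Y := by
  rw [hS.g_J_right, hS.J_succ_J, map_neg, neg_apply, neg_neg]

theorem taubNUT_kahlerForm (i : Fin 3) (m : M) (X Y : TangentSpace I m) :
    (S.taubNUT T a).kahlerForm i m X Y = S.kahlerForm i m X Y
      + a ^ 2 * (S.g m (S.J (i + 1) m (T m)) X * S.g m (S.J (i + 2) m (T m)) Y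
        - S.g m (S.J (i + 1) m (T m)) Y * S.g m (S.J (i + 2) m (T m)) X) := by
  have hs := hS.taubNUTCoeff_mul T a m
  unfold kahlerForm
  rw [taubNUT_g_apply, taubNUT_J_apply, sum_fin_three_cyclic _ i]
  simp only [map_sub, map_smul, sub_apply, smul_apply, smul_eq_mul, hS.J_isometry, hS.g_J_self,
    hS.g_J_self', hS.g_J_succ_J, hS.g_J_add_two_J, hS.g_J_right i m (T m)]
  linear_combination (S.g m (S.J i m (T m)) X * S.g m (T m) Y
    - S.g m (T m) X * S.g m (S.J i m (T m)) Y) * hs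

theorem taubNUT_J_field (i : Fin 3) (m : M) :
    (S.taubNUT T a).J i m (T m) =
      (1 - S.taubNUTCoeff T a m * S.g m (T m) (T m)) • S.J i m (T m) := by
  rw [taubNUT_J_apply, hS.g_J_self]
  module

theorem taubNUT_J_sq (i : Fin 3) (m : M) (X : TangentSpace I m) :
    (S.taubNUT T a).J i m ((S.taubNUT T a).J i m X) = -X := by
  have hs := hS.taubNUTCoeff_mul T a m
  have h1 : (S.taubNUT T a).J i m (S.J i m (T m)) =
      -(1 + a ^ 2 * S.g m (T m) (T m)) • T m := by
    rw [taubNUT_J_apply, hS.J_sq, hS.g_J_self', hS.J_isometry]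
    module
  rw [taubNUT_J_apply i m X, map_sub, map_sub, map_smul, map_smul, h1, hS.taubNUT_J_field,
    taubNUT_J_apply, hS.J_sq, hS.J_isometry, hS.g_J_right]
  match_scalars
  · ring
  · linear_combination S.g m (S.J i m (T m)) X * hs
  · linear_combination S.g m (T m) X * hs

theorem taubNUT_J_mul (i : Fin 3) (m : M) (X : TangentSpace I m) :
    (S.taubNUT T a).J i m ((S.taubNUT T a).J (i + 1) m X) = (S.taubNUT T a).J (i + 2) m X := by
  have hs := hS.taubNUTCoeff_mul T a m
  have h1 : (S.taubNUT T a).J i m (S.J (i + 1) m (T m)) = S.J (i + 2) m (T m) := by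
    rw [taubNUT_J_apply, hS.J_mul, hS.g_J_self', hS.g_J_J_succ, hS.g_J_self]
    module
  rw [taubNUT_J_apply (i + 1) m X, map_sub, map_sub, map_smul, map_smul, h1, hS.taubNUT_J_field,
    taubNUT_J_apply, hS.J_mul, hS.g_J_J_succ, hS.g_J_right, taubNUT_J_apply (i + 2) m X]
  match_scalars
  · ring
  · linear_combination S.g m (S.J (i + 1) m (T m)) X * hs
  · ring
  · ring

theorem taubNUT_metric_symm (m : M) (X Y : TangentSpace I m) :
    (S.taubNUT T a).g m X Y = (S.taubNUT T a).g m Y X := by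
  rw [taubNUT_g_apply, taubNUT_g_apply, hS.metric_symm]
  simp only [mul_comm]

/-- The modified structure is almost hyperhermitian. -/
theorem taubNUT [FiniteDimensional ℝ E] (hT : IsSmoothVectorField T) :
    (S.taubNUT T a).IsAlmostHyperhermitian where
  metric_smooth p := by
    refine contMDiffAt_hom_section fun σ hσ => contMDiffAt_hom_section
      (V₂ := Bundle.Trivial M ℝ) fun τ hτ => Bundle.contMDiffAt_totalSpace.2
      ⟨contMDiffAt_id, ?_⟩
    have hJT := fun i => hS.isSmoothVectorField_J i hT
    change ContMDiffAt I 𝓘(ℝ, ℝ) ∞ (fun q => (S.taubNUT T a).g q (σ q) (τ q)) p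
    simp only [taubNUT_g_apply]
    refine ((hS.contMDiffAt_g hσ hτ).add (contMDiffAt_const.mul (contMDiffAt_finsetSum fun i _ =>
      (hS.contMDiffAt_g (hJT i p) hσ).mul (hS.contMDiffAt_g (hJT i p) hτ)))).sub
      (ContMDiffAt.mul ?_ ((hS.contMDiffAt_g (hT p) hσ).mul (hS.contMDiffAt_g (hT p) hτ)))
    exact contMDiffAt_const.div₀ (contMDiffAt_const.add (contMDiffAt_const.mul
      (hS.contMDiffAt_g (hT p) (hT p)))) (hS.one_add_pos T a p).ne'
  metric_symm := hS.taubNUT_metric_symm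
  metric_pos m X hX := by
    have hs := hS.taubNUTCoeff_mul T a m
    have h1 := hS.one_add_pos T a m
    have hg := hS.metric_pos m X hX
    have hcs := hS.g_sq_le m (T m) X
    have hs0 : 0 ≤ S.taubNUTCoeff T a m := by unfold taubNUTCoeff; positivity
    have h2 : 0 ≤ a ^ 2 * ∑ i : Fin 3, S.g m (S.J i m (T m)) X * S.g m (S.J i m (T m)) X :=
      mul_nonneg (sq_nonneg a) (Finset.sum_nonneg fun i _ => mul_self_nonneg _)
    -- Cauchy-Schwarz bounds `s θ(X)²` by `s g(T, T) g(X, X)`, and `s g(T, T) < 1`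
    have h3 : 0 < S.g m X X - S.taubNUTCoeff T a m * (S.g m (T m) (T m) * S.g m X X) := by
      have : (S.g m X X - S.taubNUTCoeff T a m * (S.g m (T m) (T m) * S.g m X X)) *
          (1 + a ^ 2 * S.g m (T m) (T m)) = S.g m X X := by
        linear_combination - S.g m (T m) (T m) * S.g m X X * hs
      exact pos_of_mul_pos_left (by rw [this]; exact hg) h1.le
    have h4 := mul_le_mul_of_nonneg_left hcs hs0
    rw [taubNUT_g_apply]
    nlinarith
  J_smooth i p := by
    refine contMDiffAt_hom_section fun σ hσ => ?_
    have hJT := hS.isSmoothVectorField_J i hT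
    simp only [taubNUT_J_apply]
    refine ((((hS.J_smooth i p).clm_bundle_apply hσ).sub_section (ContMDiffAt.smul_section
      (ContMDiffAt.mul ?_ (hS.contMDiffAt_g (hT p) hσ)) (hJT p)))).sub_section
      (ContMDiffAt.smul_section (contMDiffAt_const.mul (hS.contMDiffAt_g (hJT p) hσ)) (hT p))
    exact contMDiffAt_const.div₀ (contMDiffAt_const.add (contMDiffAt_const.mul
      (hS.contMDiffAt_g (hT p) (hT p)))) (hS.one_add_pos T a p).ne'
  J_sq := hS.taubNUT_J_sq
  J_mul := hS.taubNUT_J_mul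
  J_isometry i m X Y := by
    -- given `J_sq`, isometry means skew symmetry of `ω_i^a`, which is plain from its formula
    have h1 := hS.taubNUT_kahlerForm (T := T) (a := a) i m X ((S.taubNUT T a).J i m Y)
    have h2 := hS.taubNUT_kahlerForm (T := T) (a := a) i m ((S.taubNUT T a).J i m Y) X
    have h3 := hS.kahlerForm_swap i m X ((S.taubNUT T a).J i m Y)
    have h4 : (S.taubNUT T a).g m ((S.taubNUT T a).J i m X) ((S.taubNUT T a).J i m Y) =
        - (S.taubNUT T a).g m ((S.taubNUT T a).J i m ((S.taubNUT T a).J i m Y)) X := by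
      unfold kahlerForm at h1 h2 h3
      linarith
    rw [h4, hS.taubNUT_J_sq, map_neg, neg_apply, neg_neg, hS.taubNUT_metric_symm]

end IsAlmostHyperhermitian

end HyperkahlerData

/-! ### The modified structure is hyperkähler -/

section Wedge

variable {E : Type*} [NormedAddCommGroup E] [NormedSpace ℝ E] [CompleteSpace E]
  {H : Type*} [TopologicalSpace H] {I : ModelWithCorners ℝ E H} [I.Boundaryless]
  {M : Type*} [TopologicalSpace M] [ChartedSpace H M] [IsManifold I ∞ M]

/-- `d(df ∧ dh) = 0`, evaluated on three vector fields. The form `df ∧ dh` is passed as `w`, so that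
the exterior derivative takes the shape it has in `HyperkahlerData.dKahlerForm`. -/
theorem extDeriv_wedge_mvfderiv {f h : M → ℝ} (hf : ContMDiff I 𝓘(ℝ, ℝ) ∞ f)
    (hh : ContMDiff I 𝓘(ℝ, ℝ) ∞ h) {m : M}
    (hf' : ∀ U : ∀ m : M, TangentSpace I m, IsSmoothVectorField U →
      MDifferentiableAt I 𝓘(ℝ, ℝ) (fun p => mvfderiv I f p (U p)) m)
    (hh' : ∀ U : ∀ m : M, TangentSpace I m, IsSmoothVectorField U →
      MDifferentiableAt I 𝓘(ℝ, ℝ) (fun p => mvfderiv I h p (U p)) m)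
    {X Y Z : ∀ m : M, TangentSpace I m} (hX : IsSmoothVectorField X) (hY : IsSmoothVectorField Y)
    (hZ : IsSmoothVectorField Z) (w : ∀ m : M, TangentSpace I m → TangentSpace I m → ℝ)
    (hw : ∀ m U V, w m U V =
      mvfderiv I f m U * mvfderiv I h m V - mvfderiv I f m V * mvfderiv I h m U) :
    mvfderiv I (fun p => w p (Y p) (Z p)) m (X m)
      - mvfderiv I (fun p => w p (X p) (Z p)) m (Y m)
      + mvfderiv I (fun p => w p (X p) (Y p)) m (Z m)
      - w m (VectorField.mlieBracket I X Y m) (Z m)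
      + w m (VectorField.mlieBracket I X Z m) (Y m)
      - w m (VectorField.mlieBracket I Y Z m) (X m) = 0 := by
  have hd : ∀ {U : ∀ m : M, TangentSpace I m}, IsSmoothVectorField U →
      MDifferentiableAt I I.tangent (fun p => (⟨p, U p⟩ : TangentBundle I M)) m :=
    fun hU => hU.mdifferentiable (by simp) m
  have hbf : ∀ {U V : ∀ m : M, TangentSpace I m}, IsSmoothVectorField U → IsSmoothVectorField V →
      _ := fun hU hV => mvfderiv_mlieBracket (hf.contMDiffAt (x := m) |>.of_le ENat.LEInfty.out)
        (hd hU) (hd hV)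
  have hbh : ∀ {U V : ∀ m : M, TangentSpace I m}, IsSmoothVectorField U → IsSmoothVectorField V →
      _ := fun hU hV => mvfderiv_mlieBracket (hh.contMDiffAt (x := m) |>.of_le ENat.LEInfty.out)
        (hd hU) (hd hV)
  have hder : ∀ {U V : ∀ m : M, TangentSpace I m}, IsSmoothVectorField U →
      IsSmoothVectorField V → ∀ v : TangentSpace I m,
      mvfderiv I (fun p => w p (U p) (V p)) m v =
        mvfderiv I f m (U m) * mvfderiv I (fun p => mvfderiv I h p (V p)) m v
        + mvfderiv I (fun p => mvfderiv I f p (U p)) m v * mvfderiv I h m (V m)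
        - mvfderiv I f m (V m) * mvfderiv I (fun p => mvfderiv I h p (U p)) m v
        - mvfderiv I (fun p => mvfderiv I f p (V p)) m v * mvfderiv I h m (U m) := by
    intro U V hU hV v
    simp only [hw]
    have hmul : ∀ {k l : M → ℝ}, MDifferentiableAt I 𝓘(ℝ, ℝ) k m →
        MDifferentiableAt I 𝓘(ℝ, ℝ) l m → MDifferentiableAt I 𝓘(ℝ, ℝ) (fun p => k p * l p) m :=
      fun hk hl => hk.mul hl
    rw [mvfderiv_fun_sub (hmul (hf' U hU) (hh' V hV)) (hmul (hf' V hV) (hh' U hU)),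
      mvfderiv_fun_mul (hf' U hU) (hh' V hV), mvfderiv_fun_mul (hf' V hV) (hh' U hU)]
    simp only [sub_apply, add_apply, smul_apply, smul_eq_mul]
    ring
  rw [hder hY hZ, hder hX hZ, hder hX hY, hw, hw, hw, hbf hX hY, hbf hX hZ, hbf hY hZ, hbh hX hY,
    hbh hX hZ, hbh hY hZ]
  ring

end Wedge

namespace HyperkahlerData

variable {E : Type*} [NormedAddCommGroup E] [NormedSpace ℝ E]
  {H : Type*} [TopologicalSpace H] {I : ModelWithCorners ℝ E H}
  {M : Type*} [TopologicalSpace M] [ChartedSpace H M] [IsManifold I ∞ M]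
  {S : HyperkahlerData I M} {T : ∀ m : M, TangentSpace I m} {a : ℝ} {x : Fin 3 → M → ℝ}
  {φ : ℝ → M → M}

theorem IsTriHamiltonian.mvfderiv_moment (hT : S.IsTriHamiltonian φ T x) (i : Fin 3) (m : M)
    (Y : TangentSpace I m) : mvfderiv I (x i) m Y = - S.g m (S.J i m (T m)) Y :=
  hT.moment i m Y

/-- `ω_i^a = ω_i + a² dx_{i+1} ∧ dx_{i+2}`. -/
theorem IsTriHamiltonian.taubNUT_kahlerForm (hT : S.IsTriHamiltonian φ T x)
    (hS : S.IsAlmostHyperhermitian) (i : Fin 3) (m : M) (X Y : TangentSpace I m) :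
    (S.taubNUT T a).kahlerForm i m X Y = S.kahlerForm i m X Y
      + a ^ 2 * (mvfderiv I (x (i + 1)) m X * mvfderiv I (x (i + 2)) m Y
        - mvfderiv I (x (i + 1)) m Y * mvfderiv I (x (i + 2)) m X) := by
  simp only [hS.taubNUT_kahlerForm, hT.mvfderiv_moment]
  ring

/-- The modified structure is hyperkähler, because `ω_i^a` differs from `ω_i` by an exact form. -/
theorem IsHyperkahler.taubNUT [FiniteDimensional ℝ E] [T2Space M] [I.Boundaryless]
    (hS : S.IsHyperkahler) (hT : S.IsTriHamiltonian φ T x) :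
    (S.taubNUT T a).IsHyperkahler := by
  have hA := hS.isAlmostHyperhermitian
  have : CompleteSpace E := FiniteDimensional.complete ℝ E
  refine (hA.taubNUT hT.field_smooth).isHyperkahler fun i X Y Z hX hY hZ m => ?_
  have hx : ∀ (j : Fin 3) (U : ∀ m : M, TangentSpace I m), IsSmoothVectorField U →
      MDifferentiableAt I 𝓘(ℝ, ℝ) (fun p => mvfderiv I (x j) p (U p)) m := by
    intro j U hU
    simp only [hT.mvfderiv_moment]
    exact ((hA.contMDiffAt_g (hA.isSmoothVectorField_J j hT.field_smooth m) (hU m)).mdifferentiableAt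
      (by simp)).neg
  have hw := extDeriv_wedge_mvfderiv (hT.moment_smooth (i + 1)) (hT.moment_smooth (i + 2))
    (hx (i + 1)) (hx (i + 2)) hX hY hZ _ (fun _ _ _ => rfl)
  have hd : ∀ {U : ∀ m : M, TangentSpace I m}, IsSmoothVectorField U →
      MDifferentiableAt I I.tangent (fun p => (⟨p, U p⟩ : TangentBundle I M)) m :=
    fun hU => hU.mdifferentiable (by simp) m
  have hder : ∀ {U V : ∀ m : M, TangentSpace I m}, IsSmoothVectorField U →
      IsSmoothVectorField V → ∀ v : TangentSpace I m,
      mvfderiv I (fun p => (S.taubNUT T a).kahlerForm i p (U p) (V p)) m v =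
        mvfderiv I (fun p => S.kahlerForm i p (U p) (V p)) m v
        + a ^ 2 * mvfderiv I (fun p => mvfderiv I (x (i + 1)) p (U p) * mvfderiv I (x (i + 2)) p (V p)
        - mvfderiv I (x (i + 1)) p (V p) * mvfderiv I (x (i + 2)) p (U p)) m v := by
    intro U V hU hV v
    simp only [hT.taubNUT_kahlerForm hA]
    have hm : MDifferentiableAt I 𝓘(ℝ, ℝ) (fun p => mvfderiv I (x (i + 1)) p (U p) *
        mvfderiv I (x (i + 2)) p (V p)
        - mvfderiv I (x (i + 1)) p (V p) * mvfderiv I (x (i + 2)) p (U p)) m :=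
      ((hx _ U hU).mul (hx _ V hV)).sub ((hx _ V hV).mul (hx _ U hU))
    have hm' : MDifferentiableAt I 𝓘(ℝ, ℝ) (fun p => a ^ 2 * (mvfderiv I (x (i + 1)) p (U p) *
        mvfderiv I (x (i + 2)) p (V p)
        - mvfderiv I (x (i + 1)) p (V p) * mvfderiv I (x (i + 2)) p (U p))) m :=
      mdifferentiableAt_const.mul hm
    rw [mvfderiv_fun_add (hA.mdifferentiableAt_kahlerForm i (hd hU) (hd hV)) hm',
      mvfderiv_fun_mul mdifferentiableAt_const hm, mvfderiv_const]
    simp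
  have h0 := hS.kahlerForm_closed i X Y Z hX hY hZ m
  unfold dKahlerForm at h0 ⊢
  rw [hder hY hZ, hder hX hZ, hder hX hY, hT.taubNUT_kahlerForm hA, hT.taubNUT_kahlerForm hA,
    hT.taubNUT_kahlerForm hA]
  linear_combination h0 + a ^ 2 * hw

/-- `ḡ` is `g` minus its part on the span of `T, I₁T, I₂T, I₃T`. -/
theorem IsHyperkahler.gBar_eq (hS : S.IsHyperkahler) {m : M} (hm : T m ≠ 0)
    (X Y : TangentSpace I m) :
    S.gBar T m X Y = S.g m X Y - S.V T m * (S.g m (T m) X * S.g m (T m) Y)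
      - S.V T m * ∑ i : Fin 3, S.g m (S.J i m (T m)) X * S.g m (S.J i m (T m)) Y := by
  obtain ⟨-, h1, h2⟩ := S.perp_spec hS T m hm X
  have hY : S.gBar T m X Y = S.g m (S.perp T m X) Y := by
    unfold gBar
    conv_lhs => rw [perp.eq_def S T m Y]
    simp [map_sub, map_sum, h1, h2]
  rw [hY, perp]
  simp only [map_sub, map_sum, map_smul, sub_apply, sum_apply, smul_apply, smul_eq_mul,
    Finset.mul_sum]
  congr 1
  · ring
  · exact Finset.sum_congr rfl fun i _ => by ring

theorem taubNUTCoeff_eq (hS : S.IsHyperkahler) {m : M} (hm : T m ≠ 0) :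
    S.taubNUTCoeff T a m = a ^ 2 * S.V T m / (a ^ 2 + S.V T m) := by
  have h := hS.metric_pos m (T m) hm
  have h' : a ^ 2 + 1 / S.g m (T m) (T m) ≠ 0 := by positivity
  have h'' : 1 + a ^ 2 * S.g m (T m) (T m) ≠ 0 := by positivity
  unfold taubNUTCoeff V
  field_simp
  ring

/-- The metric `g + a² ∑ dx_l² - s θ²` in the Gibbons-Hawking form, where `T ≠ 0`. -/
theorem IsTriHamiltonian.taubNUT_g (hT : S.IsTriHamiltonian φ T x) (hS : S.IsHyperkahler) {m : M}
    (hm : T m ≠ 0) (X Y : TangentSpace I m) :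
    (S.taubNUT T a).g m X Y = S.gBar T m X Y
      + (S.V T m + a ^ 2) * ∑ i : Fin 3, mvfderiv I (x i) m X * mvfderiv I (x i) m Y
      + 1 / (S.V T m + a ^ 2) * (S.η T m X * S.η T m Y) := by
  have h := hS.metric_pos m (T m) hm
  have hV : 0 < S.V T m := by unfold V; positivity
  have hV' : S.V T m + a ^ 2 ≠ 0 := by positivity
  rw [hS.gBar_eq hm, taubNUT_g_apply, taubNUTCoeff_eq hS hm, add_comm (a ^ 2) (S.V T m)]
  simp only [hT.mvfderiv_moment, neg_mul_neg, η, θ]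
  field_simp
  ring

theorem IsTriHamiltonian.taubNUT_J (hT : S.IsTriHamiltonian φ T x) (hS : S.IsHyperkahler) {m : M}
    (hm : T m ≠ 0) (i : Fin 3) (X : TangentSpace I m) :
    (S.taubNUT T a).J i m X = S.J i m X
      - (a ^ 2 * S.V T m / (a ^ 2 + S.V T m) * S.θ T m X) • S.J i m (T m)
      + (a ^ 2 * mvfderiv I (x i) m X) • T m := by
  rw [taubNUT_J_apply, taubNUTCoeff_eq hS hm, hT.mvfderiv_moment, θ]
  module

end HyperkahlerData

/-! ### Invariance under the flow -/

namespace HyperkahlerData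

variable {E : Type*} [NormedAddCommGroup E] [NormedSpace ℝ E]
  {H : Type*} [TopologicalSpace H] {I : ModelWithCorners ℝ E H}
  {M : Type*} [TopologicalSpace M] [ChartedSpace H M] [IsManifold I ∞ M]
  {S : HyperkahlerData I M} {T : ∀ m : M, TangentSpace I m} {a : ℝ} {x : Fin 3 → M → ℝ}
  {φ : ℝ → M → M}

omit [IsManifold I ∞ M] in
/-- A structure preserved by the differentials of the flow is invariant. -/
theorem isInvariant_of_flow {S' : HyperkahlerData I M}
    (hφ : ∀ t m (X : TangentSpace I m),
      (mfderiv I I (φ (-t)) (φ t m) (mfderiv I I (φ t) m X) : E) = X)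
    (hg : ∀ t m (X Y : TangentSpace I m),
      S'.g (φ t m) (mfderiv I I (φ t) m X) (mfderiv I I (φ t) m Y) = S'.g m X Y)
    (hJ : ∀ i t m (X : TangentSpace I m),
      S'.J i (φ t m) (mfderiv I I (φ t) m X) = mfderiv I I (φ t) m (S'.J i m X)) :
    S'.IsInvariant φ where
  lie_g m X Y := by
    simp only [hg]
    exact hasDerivAt_const _ _
  lie_J i m X := by
    have h : (fun t : ℝ =>
        (mfderiv I I (φ (-t)) (φ t m) (S'.J i (φ t m) (mfderiv I I (φ t) m X)) : E)) =
        fun _ => (S'.J i m X : E) := by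
      funext t
      rw [hJ]
      exact hφ t m _
    rw [h]
    exact hasDerivAt_const _ _
  lie_kahlerForm i m X Y := by
    unfold kahlerForm
    simp only [hJ, hg]
    exact hasDerivAt_const _ _

namespace IsTriHamiltonian

variable (hT : S.IsTriHamiltonian φ T x)
include hT

theorem contMDiff_flow (t : ℝ) : ContMDiff I I ∞ (φ t) :=
  hT.action_smooth.comp (contMDiff_const.prodMk contMDiff_id)

theorem mdifferentiableAt_flow (t : ℝ) (m : M) : MDifferentiableAt I I (φ t) m :=
  (hT.contMDiff_flow t).mdifferentiable (by simp) m

theorem flow_zero : φ 0 = id := funext hT.action_zero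

theorem flow_add (s t : ℝ) : φ (s + t) = φ s ∘ φ t := funext (hT.action_add s t)

theorem mfderiv_flow_comp (s t : ℝ) (m : M) (X : TangentSpace I m) :
    mfderiv I I (φ s ∘ φ t) m X = mfderiv I I (φ s) (φ t m) (mfderiv I I (φ t) m X) := by
  rw [mfderiv_comp m (hT.mdifferentiableAt_flow s _) (hT.mdifferentiableAt_flow t m)]
  rfl

theorem mfderiv_flow_neg_flow (t : ℝ) (m : M) (X : TangentSpace I m) :
    (mfderiv I I (φ (-t)) (φ t m) (mfderiv I I (φ t) m X) : E) = X := by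
  refine (hT.mfderiv_flow_comp (-t) t m X).symm.trans ?_
  rw [← hT.flow_add, neg_add_cancel, hT.flow_zero, mfderiv_id]
  rfl

theorem mfderiv_flow_surjective [FiniteDimensional ℝ E] (t : ℝ) (m : M) :
    Function.Surjective (mfderiv I I (φ t) m) := by
  let L : E →L[ℝ] E := mfderiv I I (φ t) m
  have h : Function.Injective L.toLinearMap := by
    intro X Y hXY
    have hX := hT.mfderiv_flow_neg_flow t m X
    have hY := hT.mfderiv_flow_neg_flow t m Y
    exact hX.symm.trans ((congrArg (fun v : E => (mfderiv I I (φ (-t)) (φ t m) v : E)) hXY).trans hY)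
  have h' : Function.Surjective L.toLinearMap := LinearMap.injective_iff_surjective.1 h
  exact h'

/-- A bilinear form whose Lie derivative along `T` vanishes is preserved by the flow of `T`. -/
theorem pullback_flow_eq (B : ∀ m : M, TangentSpace I m → TangentSpace I m → ℝ)
    (hB : ∀ (m : M) (X Y : TangentSpace I m),
      HasDerivAt (fun t : ℝ => B (φ t m) (mfderiv I I (φ t) m X) (mfderiv I I (φ t) m Y)) 0 0)
    (t : ℝ) (m : M) (X Y : TangentSpace I m) :
    B (φ t m) (mfderiv I I (φ t) m X) (mfderiv I I (φ t) m Y) = B m X Y := by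
  let G : (M → M) → ℝ := fun ψ => B (ψ m) (mfderiv I I ψ m X) (mfderiv I I ψ m Y)
  have hG0 : G (φ 0) = B m X Y := by
    rw [hT.flow_zero]
    simp only [G, mfderiv_id]
    rfl
  have hG : ∀ t, HasDerivAt (fun u => G (φ u)) 0 t := by
    intro t
    have h1 := hB (φ t m) (mfderiv I I (φ t) m X) (mfderiv I I (φ t) m Y)
    have h2 : (fun u => G (φ u)) = (fun s : ℝ => B (φ s (φ t m))
        (mfderiv I I (φ s) (φ t m) (mfderiv I I (φ t) m X))
        (mfderiv I I (φ s) (φ t m) (mfderiv I I (φ t) m Y))) ∘ fun u => u - t := by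
      funext u
      have : G (φ u) = G (φ (u - t) ∘ φ t) := by rw [← hT.flow_add, sub_add_cancel]
      rw [this]
      simp only [G, hT.mfderiv_flow_comp]
      rfl
    rw [h2]
    have h3 : HasDerivAt (fun u : ℝ => u - t) 1 t := (hasDerivAt_id t).sub_const t
    have h4 := HasDerivAt.comp t (by simpa using h1) h3
    simpa using h4
  have hconst := is_const_of_deriv_eq_zero (fun t => (hG t).differentiableAt)
    (fun t => (hG t).deriv) t 0
  exact hconst.trans hG0

theorem g_flow (t : ℝ) (m : M) (X Y : TangentSpace I m) :
    S.g (φ t m) (mfderiv I I (φ t) m X) (mfderiv I I (φ t) m Y) = S.g m X Y :=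
  hT.pullback_flow_eq (fun m X Y => S.g m X Y) hT.invariant.lie_g t m X Y

theorem kahlerForm_flow (i : Fin 3) (t : ℝ) (m : M) (X Y : TangentSpace I m) :
    S.kahlerForm i (φ t m) (mfderiv I I (φ t) m X) (mfderiv I I (φ t) m Y) =
      S.kahlerForm i m X Y :=
  hT.pullback_flow_eq (S.kahlerForm i) (hT.invariant.lie_kahlerForm i) t m X Y

/-- The flow is holomorphic for each `I_i`, as it preserves both `g` and `ω_i`. -/
theorem J_flow [FiniteDimensional ℝ E] (hS : S.IsAlmostHyperhermitian) (i : Fin 3) (t : ℝ) (m : M)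
    (X : TangentSpace I m) :
    S.J i (φ t m) (mfderiv I I (φ t) m X) = mfderiv I I (φ t) m (S.J i m X) := by
  rw [← sub_eq_zero]
  obtain ⟨Y, hY⟩ := hT.mfderiv_flow_surjective t m
    (S.J i (φ t m) (mfderiv I I (φ t) m X) - mfderiv I I (φ t) m (S.J i m X))
  by_contra h
  refine (hS.metric_pos _ _ h).ne' ?_
  have h1 := hT.kahlerForm_flow i t m X Y
  have h2 := hT.g_flow t m (S.J i m X) Y
  unfold kahlerForm at h1
  nth_rewrite 2 [← hY]
  rw [map_sub, sub_apply, h1, h2, sub_self]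

/-- The flow preserves its generator. -/
theorem field_flow (t : ℝ) (m : M) : (mfderiv I I (φ t) m (T m) : E) = T (φ t m) := by
  have h1 := (hT.mdifferentiableAt_flow t (φ 0 m)).hasMFDerivAt.comp (0 : ℝ) (hT.generator m 0)
  have h2 := hT.generator (φ t m) 0
  have h3 : (φ t ∘ fun s => φ s m) = fun s => φ s (φ t m) := by
    funext s
    simp only [Function.comp_apply, ← hT.action_add, add_comm]
  rw [h3] at h1
  have h4 := congrArg (fun L : ℝ →L[ℝ] E => L 1) (hasMFDerivAt_unique h1 h2)
  have h5 : (mfderiv I I (φ t) (φ 0 m) (T (φ 0 m)) : E) = T (φ 0 (φ t m)) := by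
    refine Eq.trans ?_ (h4.trans (one_smul ℝ (T (φ 0 (φ t m)) : E)))
    exact (congrArg (fun v : E => (mfderiv I I (φ t) (φ 0 m) v : E)) (one_smul ℝ _)).symm
  rwa [hT.action_zero, hT.action_zero] at h5

/-- The moment map is invariant, as `dx_i(T) = - ω_i(T, T) = 0`. -/
theorem moment_flow (hS : S.IsAlmostHyperhermitian) (i : Fin 3) (t : ℝ) (m : M) :
    x i (φ t m) = x i m := by
  have hd : ∀ t, HasDerivAt (fun t => x i (φ t m)) 0 t := by
    intro t
    have h1 := ((hT.moment_smooth i).mdifferentiable (by simp) (φ t m)).hasMFDerivAt.comp t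
      (hT.generator m t)
    have h2 : HasFDerivAt (fun t => x i (φ t m)) _ t := hasMFDerivAt_iff_hasFDerivAt.1 h1
    refine HasDerivAt.congr_deriv (HasFDerivAt.hasDerivAt h2) ?_
    have h3 := hT.moment i (φ t m) (T (φ t m))
    rw [hS.kahlerForm_self, neg_zero] at h3
    refine Eq.trans ?_ h3
    exact congrArg (fun v : E => (mvfderiv I (x i) (φ t m) : E →L[ℝ] ℝ) v) (one_smul ℝ _)
  have := is_const_of_deriv_eq_zero (fun t => (hd t).differentiableAt) (fun t => (hd t).deriv) t 0
  simpa [hT.action_zero] using this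

theorem g_J_field_flow [FiniteDimensional ℝ E] (hS : S.IsAlmostHyperhermitian) (i : Fin 3) (t : ℝ)
    (m : M) (X : TangentSpace I m) :
    S.g (φ t m) (S.J i (φ t m) (T (φ t m))) (mfderiv I I (φ t) m X) = S.g m (S.J i m (T m)) X := by
  have h : mfderiv I I (φ t) m (T m) = T (φ t m) := hT.field_flow t m
  rw [← h, hT.J_flow hS, hT.g_flow]

theorem g_field_flow (t : ℝ) (m : M) (X : TangentSpace I m) :
    S.g (φ t m) (T (φ t m)) (mfderiv I I (φ t) m X) = S.g m (T m) X := by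
  have h : mfderiv I I (φ t) m (T m) = T (φ t m) := hT.field_flow t m
  rw [← h, hT.g_flow]

theorem taubNUTCoeff_flow (t : ℝ) (m : M) :
    S.taubNUTCoeff T a (φ t m) = S.taubNUTCoeff T a m := by
  have h : mfderiv I I (φ t) m (T m) = T (φ t m) := hT.field_flow t m
  unfold taubNUTCoeff
  rw [← h, hT.g_flow]

theorem taubNUT_g_flow [FiniteDimensional ℝ E] (hS : S.IsAlmostHyperhermitian) (t : ℝ) (m : M)
    (X Y : TangentSpace I m) :
    (S.taubNUT T a).g (φ t m) (mfderiv I I (φ t) m X) (mfderiv I I (φ t) m Y) =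
      (S.taubNUT T a).g m X Y := by
  simp only [taubNUT_g_apply, hT.g_flow, hT.g_J_field_flow hS, hT.g_field_flow,
    hT.taubNUTCoeff_flow]

theorem taubNUT_J_flow [FiniteDimensional ℝ E] (hS : S.IsAlmostHyperhermitian) (i : Fin 3) (t : ℝ)
    (m : M) (X : TangentSpace I m) :
    (S.taubNUT T a).J i (φ t m) (mfderiv I I (φ t) m X) =
      mfderiv I I (φ t) m ((S.taubNUT T a).J i m X) := by
  have h : mfderiv I I (φ t) m (T m) = T (φ t m) := hT.field_flow t m
  simp only [taubNUT_J_apply, hT.g_J_field_flow hS, hT.g_field_flow, hT.taubNUTCoeff_flow, map_sub,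
    map_smul, ← hT.J_flow hS, h]

theorem taubNUT_kahlerForm_flow [FiniteDimensional ℝ E] (hS : S.IsAlmostHyperhermitian) (i : Fin 3)
    (t : ℝ) (m : M) (X Y : TangentSpace I m) :
    (S.taubNUT T a).kahlerForm i (φ t m) (mfderiv I I (φ t) m X) (mfderiv I I (φ t) m Y) =
      (S.taubNUT T a).kahlerForm i m X Y := by
  unfold kahlerForm
  rw [hT.taubNUT_J_flow hS, hT.taubNUT_g_flow hS]

theorem taubNUT_isInvariant [FiniteDimensional ℝ E] (hS : S.IsAlmostHyperhermitian) :
    (S.taubNUT T a).IsInvariant φ :=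
  isInvariant_of_flow hT.mfderiv_flow_neg_flow (hT.taubNUT_g_flow hS) (hT.taubNUT_J_flow hS)

end IsTriHamiltonian

end HyperkahlerData

/-! ### The action on the product -/

theorem inner_quaternionUnit (i : Fin 3) (q : ℍ[ℝ]) :
    inner ℝ (quaternionUnit i) q = ![q.imI, q.imJ, q.imK] i := by
  rw [quaternion_inner_eq]
  fin_cases i <;> simp [quaternionUnit]

theorem inner_quaternionUnit_quaternionUnit (i j : Fin 3) :
    inner ℝ (quaternionUnit i) (quaternionUnit j) = if i = j then (1 : ℝ) else 0 := by
  rw [inner_quaternionUnit]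
  fin_cases i <;> fin_cases j <;> simp [quaternionUnit]

theorem hasDerivAt_quaternion_coe (t : ℝ) : HasDerivAt (fun t : ℝ => (t : ℍ[ℝ])) 1 t :=
  ((algebraMapCLM ℝ ℍ[ℝ]).hasDerivAt (x := t)).congr_deriv (map_one (algebraMap ℝ ℍ[ℝ]))

theorem contDiff_quaternion_coe : ContDiff ℝ ∞ (fun t : ℝ => (t : ℍ[ℝ])) :=
  (algebraMapCLM ℝ ℍ[ℝ]).contDiff

theorem taubNUTMoment_eq {M : Type*} (a : ℝ) (x : Fin 3 → M → ℝ) (i : Fin 3) (p : M × ℍ[ℝ]) :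
    taubNUTMoment a x i p = a * x i p.1 - inner ℝ (quaternionUnit i) p.2 := by
  rw [inner_quaternionUnit]
  rfl

namespace HyperkahlerData

variable {E : Type*} [NormedAddCommGroup E] [NormedSpace ℝ E]
  {H : Type*} [TopologicalSpace H] {I : ModelWithCorners ℝ E H}
  {M : Type*} [TopologicalSpace M] [ChartedSpace H M] [IsManifold I ∞ M]
  {S : HyperkahlerData I M} {T : ∀ m : M, TangentSpace I m} {a : ℝ} {x : Fin 3 → M → ℝ}
  {φ : ℝ → M → M}

namespace IsTriHamiltonian

variable (hT : S.IsTriHamiltonian φ T x)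
include hT

/-- `dμ_i = a dx_i - dq_i`. -/
theorem mvfderiv_taubNUTMoment (i : Fin 3) (p : M × ℍ[ℝ])
    (X : TangentSpace (I.prod 𝓘(ℝ, ℍ[ℝ])) p) :
    mvfderiv (I.prod 𝓘(ℝ, ℍ[ℝ])) (taubNUTMoment a x i) p X =
      a * mvfderiv I (x i) p.1 X.1 - inner ℝ (quaternionUnit i) (X.2 : ℍ[ℝ]) := by
  have h1 : HasMFDerivAt (I.prod 𝓘(ℝ, ℍ[ℝ])) 𝓘(ℝ, ℝ) (fun p : M × ℍ[ℝ] => x i p.1) p _ :=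
    ((hT.moment_smooth i).mdifferentiable (by simp) p.1).hasMFDerivAt.comp p
      (hasMFDerivAt_fst (I := I) (I' := 𝓘(ℝ, ℍ[ℝ])) p)
  have h2 : HasMFDerivAt (I.prod 𝓘(ℝ, ℍ[ℝ])) 𝓘(ℝ, ℝ)
      (fun p : M × ℍ[ℝ] => innerSL ℝ (quaternionUnit i) p.2) p _ :=
    (innerSL ℝ (quaternionUnit i)).hasMFDerivAt.comp p
      (hasMFDerivAt_snd (I := I) (I' := 𝓘(ℝ, ℍ[ℝ])) p)
  have h3 := (h1.const_smul a).sub h2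
  have h4 : taubNUTMoment a x i = a • (fun p : M × ℍ[ℝ] => x i p.1) -
      fun p : M × ℍ[ℝ] => innerSL ℝ (quaternionUnit i) p.2 := by
    funext p
    rw [taubNUTMoment_eq]
    rfl
  rw [← h4] at h3
  exact congrArg (fun L : E × ℍ[ℝ] →L[ℝ] ℝ => L X) h3.mfderiv

theorem hasMFDerivAt_taubNUTAction (t : ℝ) (p : M × ℍ[ℝ]) :
    HasMFDerivAt (I.prod 𝓘(ℝ, ℍ[ℝ])) (I.prod 𝓘(ℝ, ℍ[ℝ])) (taubNUTAction a φ t) p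
      ((mfderiv I I (φ (a * t)) p.1 : E →L[ℝ] E).prodMap (ContinuousLinearMap.id ℝ ℍ[ℝ]) :
        E × ℍ[ℝ] →L[ℝ] E × ℍ[ℝ]) := by
  have h1 : HasMFDerivAt (I.prod 𝓘(ℝ, ℍ[ℝ])) I (fun p : M × ℍ[ℝ] => φ (a * t) p.1) p _ :=
    (hT.mdifferentiableAt_flow (a * t) p.1).hasMFDerivAt.comp p
      (hasMFDerivAt_fst (I := I) (I' := 𝓘(ℝ, ℍ[ℝ])) p)
  have h2 : HasMFDerivAt (I.prod 𝓘(ℝ, ℍ[ℝ])) 𝓘(ℝ, ℍ[ℝ])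
      (fun p : M × ℍ[ℝ] => p.2 + (t : ℍ[ℝ])) p _ :=
    (((hasFDerivAt_id p.2).add_const (t : ℍ[ℝ])).hasMFDerivAt).comp p
      (hasMFDerivAt_snd (I := I) (I' := 𝓘(ℝ, ℍ[ℝ])) p)
  exact h1.prodMk h2

theorem mfderiv_taubNUTAction (t : ℝ) (p : M × ℍ[ℝ]) (X : TangentSpace (I.prod 𝓘(ℝ, ℍ[ℝ])) p) :
    mfderiv (I.prod 𝓘(ℝ, ℍ[ℝ])) (I.prod 𝓘(ℝ, ℍ[ℝ])) (taubNUTAction a φ t) p X =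
      ((mfderiv I I (φ (a * t)) p.1 X.1, X.2) : E × ℍ[ℝ]) :=
  congrArg (fun L : E × ℍ[ℝ] →L[ℝ] E × ℍ[ℝ] => L X) (hT.hasMFDerivAt_taubNUTAction t p).mfderiv

theorem prodQuaternion_isInvariant [FiniteDimensional ℝ E] (hS : S.IsAlmostHyperhermitian) :
    S.prodQuaternion.IsInvariant (taubNUTAction a φ) := by
  refine isInvariant_of_flow (fun t p X => ?_) (fun t p X Y => ?_) fun i t p X => ?_
  · rw [hT.mfderiv_taubNUTAction, hT.mfderiv_taubNUTAction]
    refine Prod.ext ?_ rfl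
    have h := hT.mfderiv_flow_neg_flow (a * t) p.1 X.1
    rw [← mul_neg] at h
    exact h
  · rw [hT.mfderiv_taubNUTAction, hT.mfderiv_taubNUTAction]
    exact congrArg (· + inner ℝ (X.2 : ℍ[ℝ]) (Y.2 : ℍ[ℝ])) (hT.g_flow (a * t) p.1 X.1 Y.1)
  · rw [hT.mfderiv_taubNUTAction, hT.mfderiv_taubNUTAction]
    exact Prod.ext (hT.J_flow hS i (a * t) p.1 X.1) rfl

/-- `a T + ∂/∂q₀` generates a tri-Hamiltonian action on `M × ℍ` with moment map `a x_i - q_i`. -/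
theorem prodQuaternion [FiniteDimensional ℝ E] (hS : S.IsAlmostHyperhermitian) :
    S.prodQuaternion.IsTriHamiltonian (taubNUTAction a φ) (taubNUTField a T)
      (taubNUTMoment a x) where
  field_smooth p := by
    refine contMDiffAt_prod_vectorField_iff.2 ⟨?_, contMDiffAt_const⟩
    have h : IsSmoothVectorField (fun m => a • T m) := hT.field_smooth.const_smul_section
    exact h.contMDiffAt.comp p contMDiffAt_fst
  action_smooth := by
    refine ContMDiff.prodMk ?_ ?_
    · refine hT.action_smooth.comp (ContMDiff.prodMk ?_ ?_)
      · exact (contDiff_const.mul contDiff_id).contMDiff.comp contMDiff_fst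
      · exact contMDiff_fst.comp contMDiff_snd
    · refine ContMDiff.add (contMDiff_snd.comp contMDiff_snd) ?_
      exact contDiff_quaternion_coe.contMDiff.comp contMDiff_fst
  action_zero p := by
    simp [taubNUTAction, hT.action_zero]
  action_add s t p := by
    simp only [taubNUTAction, mul_add, hT.action_add, Quaternion.coe_add]
    rw [add_comm (s : ℍ[ℝ]), add_assoc]
  generator p t := by
    have h1 := (hT.generator p.1 (a * t)).comp t
      (((hasDerivAt_id t).const_mul a).hasFDerivAt.hasMFDerivAt)
    have h2 := ((hasDerivAt_quaternion_coe t).const_add p.2).hasFDerivAt.hasMFDerivAt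
    have h3 := h1.prodMk h2
    refine HasMFDerivAt.congr_mfderiv h3 ?_
    refine ContinuousLinearMap.ext fun s : ℝ => Prod.ext ?_ ?_
    · change ((s • (a * 1)) • (T (φ (a * t) p.1) : E) : E) = s • a • (T (φ (a * t) p.1) : E)
      rw [mul_one, smul_assoc]
    · rfl
  invariant := hT.prodQuaternion_isInvariant hS
  moment_smooth i := by
    have h : taubNUTMoment a x i = fun p => a * x i p.1 - innerSL ℝ (quaternionUnit i) p.2 :=
      funext fun p => taubNUTMoment_eq a x i p
    rw [h]
    refine ContMDiff.sub ?_ ((innerSL ℝ (quaternionUnit i)).contMDiff.comp contMDiff_snd)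
    exact contMDiff_const.mul ((hT.moment_smooth i).comp contMDiff_fst)
  moment i p Y := by
    refine (hT.mvfderiv_taubNUTMoment i p Y).trans ?_
    have h1 : S.prodQuaternion.kahlerForm i p (taubNUTField a T p) Y =
        a * S.kahlerForm i p.1 (T p.1) Y.1 + inner ℝ (quaternionUnit i) (Y.2 : ℍ[ℝ]) := by
      refine (prodQuaternion_kahlerForm_apply i p _ Y).trans (congrArg₂ (· + ·) ?_ ?_)
      · have h : ∀ v : TangentSpace I p.1, S.kahlerForm i p.1 (a • T p.1) v =
            a * S.kahlerForm i p.1 (T p.1) v := fun v => by simp [kahlerForm]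
        exact h _
      · exact congrArg (inner ℝ · (Y.2 : ℍ[ℝ])) (mul_one (quaternionUnit i))
    have h2 := hT.moment i p.1 Y.1
    linear_combination a * h2 + h1

end IsTriHamiltonian

end HyperkahlerData

/-! ### The quotient of the product -/

/-- A quaternion is determined by its real part and its inner products with `i`, `j`, `k`. -/
theorem quaternion_ext_of_inner {p q : ℍ[ℝ]} (h0 : p.re = q.re)
    (h : ∀ i, inner ℝ (quaternionUnit i) p = inner ℝ (quaternionUnit i) q) : p = q := by
  simp only [inner_quaternionUnit] at h
  exact QuaternionAlgebra.ext h0 (h 0) (h 1) (h 2)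

theorem quaternion_inner_eq_sum (p q : ℍ[ℝ]) :
    inner ℝ p q = p.re * q.re +
      ∑ i, inner ℝ (quaternionUnit i) p * inner ℝ (quaternionUnit i) q := by
  rw [quaternion_inner_eq p q]
  simp only [inner_quaternionUnit, Fin.sum_univ_three, Matrix.cons_val]
  ring

theorem inner_quaternionUnit_mul_left (i : Fin 3) (p q : ℍ[ℝ]) :
    inner ℝ (quaternionUnit i * p) q =
      p.re * inner ℝ (quaternionUnit i) q - inner ℝ (quaternionUnit i) p * q.re
      + inner ℝ (quaternionUnit (i + 1)) p * inner ℝ (quaternionUnit (i + 2)) q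
      - inner ℝ (quaternionUnit (i + 2)) p * inner ℝ (quaternionUnit (i + 1)) q := by
  simp only [quaternion_inner_eq, Quaternion.re_mul, Quaternion.imI_mul, Quaternion.imJ_mul,
    Quaternion.imK_mul]
  fin_cases i <;> simp [quaternionUnit] <;> ring

theorem re_sum_smul_quaternionUnit (f : Fin 3 → ℝ) : (∑ i, f i • quaternionUnit i).re = 0 := by
  rw [Fin.sum_univ_three]
  simp only [Quaternion.re_add, Quaternion.re_smul]
  simp [quaternionUnit]

theorem inner_sum_smul_quaternionUnit (f : Fin 3 → ℝ) (j : Fin 3) :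
    inner ℝ (quaternionUnit j) (∑ i, f i • quaternionUnit i) = f j := by
  simp [inner_sum, inner_smul_right, inner_quaternionUnit_quaternionUnit]

/-- The map `M × ℍ → M` which moves `(m, q)` along its orbit to `q₀ = 0` and forgets `q`. -/
def taubNUTProj {M : Type*} (a : ℝ) (φ : ℝ → M → M) (p : M × ℍ[ℝ]) : M :=
  φ (-(a * p.2.re)) p.1

/-- The slice `{q₀ = 0}` of the level set `μ⁻¹(c)`, parametrized by `M`. -/
def taubNUTSlice {M : Type*} (a : ℝ) (x : Fin 3 → M → ℝ) (c : Fin 3 → ℝ) (m : M) : M × ℍ[ℝ] :=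
  (m, ∑ i, (a * x i m - c i) • quaternionUnit i)

theorem taubNUTSlice_mem {M : Type*} (a : ℝ) (x : Fin 3 → M → ℝ) (c : Fin 3 → ℝ) (m : M) :
    taubNUTSlice a x c m ∈ HyperkahlerData.levelSet (taubNUTMoment a x) c := fun i => by
  rw [taubNUTMoment_eq, taubNUTSlice, inner_sum_smul_quaternionUnit]
  ring

namespace HyperkahlerData

variable {E : Type*} [NormedAddCommGroup E] [NormedSpace ℝ E]
  {H : Type*} [TopologicalSpace H] {I : ModelWithCorners ℝ E H}
  {M : Type*} [TopologicalSpace M] [ChartedSpace H M] [IsManifold I ∞ M]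
  {S : HyperkahlerData I M} {T : ∀ m : M, TangentSpace I m} {a : ℝ} {x : Fin 3 → M → ℝ}
  {φ : ℝ → M → M} {c : Fin 3 → ℝ}

namespace IsTriHamiltonian

variable (hT : S.IsTriHamiltonian φ T x)
include hT

theorem mvfderiv_moment_field (hS : S.IsAlmostHyperhermitian) (i : Fin 3) (m : M) :
    mvfderiv I (x i) m (T m) = 0 := by
  rw [hT.moment, hS.kahlerForm_self, neg_zero]

theorem contMDiff_taubNUTProj :
    ContMDiff (I.prod 𝓘(ℝ, ℍ[ℝ])) I ∞ (taubNUTProj a φ) := by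
  refine hT.action_smooth.comp (ContMDiff.prodMk ?_ contMDiff_fst)
  have h : (fun p : M × ℍ[ℝ] => -(a * p.2.re)) =
      fun p => -(a * innerSL ℝ (1 : ℍ[ℝ]) p.2) := by
    funext p
    simp [quaternion_inner_eq]
  rw [h]
  exact (contMDiff_const.mul ((innerSL ℝ (1 : ℍ[ℝ])).contMDiff.comp contMDiff_snd)).neg

/-- The differential of `(m, q) ↦ φ_{-a q₀}(m)` is `(X, p) ↦ dφ(X - a p₀ T)`. -/
theorem mfderiv_taubNUTProj (p : M × ℍ[ℝ]) (X : TangentSpace I p.1) (q : ℍ[ℝ]) :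
    mfderiv (I.prod 𝓘(ℝ, ℍ[ℝ])) I (taubNUTProj a φ) p ((X, q) : E × ℍ[ℝ]) =
      mfderiv I I (φ (-(a * p.2.re))) p.1 (X - (a * q.re) • T p.1) := by
  have h := mfderiv_prod_eq_add_apply (v := ((X, q) : E × ℍ[ℝ]))
    (hT.contMDiff_taubNUTProj.mdifferentiable (by simp) p : MDifferentiableAt _ _ (taubNUTProj a φ) p)
  have h0 : HasDerivAt (fun q : ℝ => -(a * q)) (-a) p.2.re :=
    (((hasDerivAt_id p.2.re).const_mul a).neg).congr_deriv (by rw [mul_one])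
  have h1 := (hT.generator p.1 (-(a * p.2.re))).comp p.2.re h0.hasFDerivAt.hasMFDerivAt
  have hre : HasFDerivAt (fun q : ℍ[ℝ] => q.re) (innerSL ℝ (1 : ℍ[ℝ])) p.2 := by
    have : (fun q : ℍ[ℝ] => q.re) = innerSL ℝ (1 : ℍ[ℝ]) := by
      funext q
      simp [quaternion_inner_eq]
    rw [this]
    exact ContinuousLinearMap.hasFDerivAt _
  have h2 := (h1.comp p.2 hre.hasMFDerivAt).mfderiv
  have h3 : (mfderiv 𝓘(ℝ, ℍ[ℝ]) I (fun q => taubNUTProj a φ (p.1, q)) p.2 q : E) =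
      (inner ℝ (1 : ℍ[ℝ]) q * -a) • (T (φ (-(a * p.2.re)) p.1) : E) :=
    congrArg (fun L : ℍ[ℝ] →L[ℝ] E => L q) h2
  have h4 : inner ℝ (1 : ℍ[ℝ]) q = q.re := by simp [quaternion_inner_eq]
  have h5 := hT.field_flow (-(a * p.2.re)) p.1
  let u : E := mfderiv I I (φ (-(a * p.2.re))) p.1 X
  have h6 : ∀ u w : E, u + (inner ℝ (1 : ℍ[ℝ]) q * -a) • w = u - (a * q.re) • w := by
    intro u w
    rw [h4]
    module
  rw [map_sub, map_smul]
  refine h.trans ((congrArg (fun v : E => u + v) h3).trans ((h6 u _).trans ?_))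
  exact congrArg (fun v : E => u - (a * q.re) • v) h5.symm

/-- On the tangent space of the level set, the pullback of `ω_i^a` under `(X, p) ↦ X - a p₀ T` is the
Kähler form of the product. -/
theorem taubNUT_kahlerForm_sub_smul (hS : S.IsAlmostHyperhermitian) (i : Fin 3) (m : M)
    (X Y : TangentSpace I m) (p q : ℍ[ℝ])
    (hX : ∀ j, inner ℝ (quaternionUnit j) p = a * mvfderiv I (x j) m X)
    (hY : ∀ j, inner ℝ (quaternionUnit j) q = a * mvfderiv I (x j) m Y) :
    (S.taubNUT T a).kahlerForm i m (X - (a * p.re) • T m) (Y - (a * q.re) • T m) =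
      S.kahlerForm i m X Y + inner ℝ (quaternionUnit i * p) q := by
  have h1 : S.kahlerForm i m (X - (a * p.re) • T m)
      (Y - (a * q.re) • T m) = S.kahlerForm i m X Y - a * q.re * S.kahlerForm i m X (T m)
        - a * p.re * S.kahlerForm i m (T m) Y := by
    have := hS.kahlerForm_self i m (T m)
    simp only [kahlerForm, map_sub, map_smul, sub_apply, smul_apply, smul_eq_mul] at this ⊢
    rw [this]
    ring
  rw [hT.taubNUT_kahlerForm hS, inner_quaternionUnit_mul_left, h1,
    hS.kahlerForm_swap i m X (T m)]
  simp only [hX, hY, map_sub, map_smul, hT.mvfderiv_moment_field hS, smul_zero, sub_zero]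
  linear_combination (-a * p.re) * hT.moment i m Y + a * q.re * hT.moment i m X

/-- The map `(X, p) ↦ X - a p₀ T` is an isometry on vectors tangent to the level set and orthogonal to
the orbit. -/
theorem taubNUT_g_sub_smul (hS : S.IsAlmostHyperhermitian) (m : M)
    (X Y : TangentSpace I m) (p q : ℍ[ℝ])
    (hX : ∀ j, inner ℝ (quaternionUnit j) p = a * mvfderiv I (x j) m X)
    (hY : ∀ j, inner ℝ (quaternionUnit j) q = a * mvfderiv I (x j) m Y)
    (hp : p.re = -(a * S.g m (T m) X)) (hq : q.re = -(a * S.g m (T m) Y)) :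
    (S.taubNUT T a).g m (X - (a * p.re) • T m) (Y - (a * q.re) • T m) =
      S.g m X Y + inner ℝ p q := by
  have hs := hS.taubNUTCoeff_mul T a m
  rw [taubNUT_g_apply, quaternion_inner_eq_sum, hp, hq]
  simp only [hX, hY, hT.mvfderiv_moment, map_sub, map_smul, sub_apply, smul_apply, smul_eq_mul,
    hS.g_J_self, hS.metric_symm m X (T m), Fin.sum_univ_three]
  linear_combination (-(S.g m (T m) X * S.g m (T m) Y) *
    (1 + a ^ 2 * S.g m (T m) (T m))) * hs

theorem taubNUTProj_taubNUTSlice (m : M) : taubNUTProj a φ (taubNUTSlice a x c m) = m := by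
  rw [taubNUTProj, taubNUTSlice, re_sum_smul_quaternionUnit, mul_zero, neg_zero, hT.action_zero]

/-- On a level set, the fibres of `(m, q) ↦ φ_{-a q₀}(m)` are the orbits. The imaginary part of `q` is
determined by the moment map, which is constant along the flow. -/
theorem taubNUTProj_eq_iff (hS : S.IsAlmostHyperhermitian) {p p' : M × ℍ[ℝ]}
    (hp : p ∈ levelSet (taubNUTMoment a x) c) (hp' : p' ∈ levelSet (taubNUTMoment a x) c) :
    taubNUTProj a φ p = taubNUTProj a φ p' ↔ ∃ t, taubNUTAction a φ t p = p' := by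
  constructor
  · intro h
    have h1 : φ (a * (p'.2.re - p.2.re)) p.1 = p'.1 := by
      have h2 := congrArg (φ (a * p'.2.re)) h
      rw [taubNUTProj, taubNUTProj, ← hT.action_add, ← hT.action_add, add_neg_cancel,
        hT.action_zero] at h2
      rw [← h2]
      congr 1
      ring
    refine ⟨p'.2.re - p.2.re, Prod.ext h1 (quaternion_ext_of_inner ?_ fun i => ?_)⟩
    · simp [taubNUTAction]
    · have h3 := hp i
      have h4 := hp' i
      rw [taubNUTMoment_eq] at h3 h4
      rw [← h1, hT.moment_flow hS] at h4
      have h5 : inner ℝ (quaternionUnit i) ((p'.2.re - p.2.re : ℝ) : ℍ[ℝ]) = 0 := by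
        rw [inner_quaternionUnit]
        fin_cases i <;> simp
      rw [taubNUTAction, inner_add_right, h5]
      linarith
  · rintro ⟨t, rfl⟩
    rw [taubNUTProj, taubNUTProj, taubNUTAction, ← hT.action_add]
    congr 1
    simp
    ring

/-- Vectors `(X, p)` tangent to the level set satisfy `p_j = a dx_j(X)`. -/
theorem inner_quaternionUnit_of_mvfderiv_eq_zero {p : M × ℍ[ℝ]}
    {X : TangentSpace (I.prod 𝓘(ℝ, ℍ[ℝ])) p}
    (hX : ∀ j, mvfderiv (I.prod 𝓘(ℝ, ℍ[ℝ])) (taubNUTMoment a x j) p X = 0) (j : Fin 3) :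
    inner ℝ (quaternionUnit j) (X.2 : ℍ[ℝ]) = a * mvfderiv I (x j) p.1 X.1 := by
  have h := hT.mvfderiv_taubNUTMoment (a := a) j p X
  rw [hX j] at h
  linarith

/-- Every value of the moment map is regular: `dμ_i` takes the value `-δ_{ij}` on `∂/∂q_j`. -/
theorem linearIndependent_mvfderiv_taubNUTMoment (p : M × ℍ[ℝ]) :
    LinearIndependent ℝ
      (fun i : Fin 3 => mvfderiv (I.prod 𝓘(ℝ, ℍ[ℝ])) (taubNUTMoment a x i) p) := by
  rw [Fintype.linearIndependent_iff]
  intro f hf j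
  have h1 : ∀ i, mvfderiv (I.prod 𝓘(ℝ, ℍ[ℝ])) (taubNUTMoment a x i) p
      ((0, quaternionUnit j) : E × ℍ[ℝ]) = if i = j then -1 else 0 := fun i => by
    refine (hT.mvfderiv_taubNUTMoment i p _).trans ?_
    have h2 : mvfderiv I (x i) p.1 (0 : TangentSpace I p.1) = 0 := map_zero _
    have h3 := inner_quaternionUnit_quaternionUnit i j
    refine (congrArg₂ (fun u v => a * u - v) h2 h3).trans ?_
    split_ifs <;> simp
  have h : ∀ L : Fin 3 → E × ℍ[ℝ] →L[ℝ] ℝ, ∑ i, f i • L i = 0 →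
      ∑ i, f i * L i (0, quaternionUnit j) = 0 := fun L hL => by
    simpa [sum_apply] using congrArg (fun L : E × ℍ[ℝ] →L[ℝ] ℝ => L (0, quaternionUnit j)) hL
  have h2 : ∑ i, f i * (if i = j then -1 else 0) = 0 :=
    (Finset.sum_congr rfl fun i _ => congrArg (f i * ·) (h1 i).symm).trans (h _ hf)
  simpa using h2

/-- `M` with the modified structure is a hyperkähler quotient of `M × ℍ` at every level. -/
theorem isQuotient_taubNUT [FiniteDimensional ℝ E] [T2Space M] [I.Boundaryless]
    (hS : S.IsHyperkahler) (c : Fin 3 → ℝ) :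
    S.prodQuaternion.IsQuotient (taubNUTAction a φ) (taubNUTField a T) (taubNUTMoment a x) c
      (S.taubNUT T a) (taubNUTProj a φ) where
  hyperkahler := hS.taubNUT hT
  regular p _ := hT.linearIndependent_mvfderiv_taubNUTMoment p
  free p _ t ht := by
    have h := congrArg (fun p : M × ℍ[ℝ] => p.2.re) ht
    simpa [taubNUTAction] using h
  surjective m := ⟨taubNUTSlice a x c m, taubNUTSlice_mem a x c m,
    hT.taubNUTProj_taubNUTSlice m⟩
  fibres p hp p' hp' := hT.taubNUTProj_eq_iff hS.isAlmostHyperhermitian hp hp'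
  smooth := hT.contMDiff_taubNUTProj.contMDiffOn
  submersion p hp := by
    have hA := hS.isAlmostHyperhermitian
    refine ⟨mfderiv (I.prod 𝓘(ℝ, ℍ[ℝ])) I (taubNUTProj a φ) p,
      ((hT.contMDiff_taubNUTProj.mdifferentiable (by simp) p).hasMFDerivAt).hasMFDerivWithinAt,
      fun v => ?_, fun i X Y hX hY => ?_, fun X Y hX hY hX' hY' => ?_⟩
    · obtain ⟨X, hX⟩ := hT.mfderiv_flow_surjective (-(a * p.2.re)) p.1 v
      refine ⟨((X, ∑ i, (a * mvfderiv I (x i) p.1 X) • quaternionUnit i) : E × ℍ[ℝ]),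
        fun i => ?_, ?_⟩
      · refine (hT.mvfderiv_taubNUTMoment i p _).trans ?_
        exact sub_eq_zero.2 (inner_sum_smul_quaternionUnit
          (fun i => a * mvfderiv I (x i) p.1 X) i).symm
      · refine (hT.mfderiv_taubNUTProj p X _).trans ?_
        rw [re_sum_smul_quaternionUnit, mul_zero, zero_smul, sub_zero]
        exact hX
    · have hX' := hT.inner_quaternionUnit_of_mvfderiv_eq_zero hX
      have hY' := hT.inner_quaternionUnit_of_mvfderiv_eq_zero hY
      refine Eq.trans ?_ (hT.taubNUT_kahlerForm_sub_smul hA i p.1 X.1 Y.1 X.2 Y.2 hX' hY')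
      refine Eq.trans ?_ (hT.taubNUT_kahlerForm_flow hA i (-(a * p.2.re)) p.1 _ _)
      exact congrArg₂ (fun u v : E => (S.taubNUT T a).kahlerForm i (taubNUTProj a φ p) u v)
        (hT.mfderiv_taubNUTProj p X.1 X.2) (hT.mfderiv_taubNUTProj p Y.1 Y.2)
    · have hX₁ := hT.inner_quaternionUnit_of_mvfderiv_eq_zero hX
      have hY₁ := hT.inner_quaternionUnit_of_mvfderiv_eq_zero hY
      -- orthogonality to `Z = a T + ∂/∂q₀` means `p₀ = - a θ(X)`
      have hre : ∀ X : TangentSpace (I.prod 𝓘(ℝ, ℍ[ℝ])) p,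
          S.prodQuaternion.g p (taubNUTField a T p) X = 0 →
          (X.2 : ℍ[ℝ]).re = -(a * S.g p.1 (T p.1) X.1) := by
        intro X h
        have h1 : S.g p.1 (a • T p.1) (X.1 : TangentSpace I p.1) +
          inner ℝ (1 : ℍ[ℝ]) (X.2 : ℍ[ℝ]) = 0 := h
        have h2 : inner ℝ (1 : ℍ[ℝ]) (X.2 : ℍ[ℝ]) = (X.2 : ℍ[ℝ]).re := by
          simp [quaternion_inner_eq]
        have h3 : ∀ v : TangentSpace I p.1, S.g p.1 (a • T p.1) v = a * S.g p.1 (T p.1) v :=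
          fun v => by simp
        linear_combination h1 - h2 - h3 X.1
      refine Eq.trans ?_ (hT.taubNUT_g_sub_smul hA p.1 X.1 Y.1 X.2 Y.2 hX₁ hY₁
        (hre X hX') (hre Y hY'))
      refine Eq.trans ?_ (hT.taubNUT_g_flow hA (-(a * p.2.re)) p.1 _ _)
      exact congrArg₂ (fun u v : E => (S.taubNUT T a).g (taubNUTProj a φ p) u v)
        (hT.mfderiv_taubNUTProj p X.1 X.2) (hT.mfderiv_taubNUTProj p Y.1 Y.2)

end IsTriHamiltonian

end HyperkahlerData

/-! ### Bijections with invertible differential -/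

section InverseFunction

variable {E : Type*} [NormedAddCommGroup E] [NormedSpace ℝ E] [FiniteDimensional ℝ E]
  {H : Type*} [TopologicalSpace H] {I : ModelWithCorners ℝ E H} [I.Boundaryless]
  {M : Type*} [TopologicalSpace M] [ChartedSpace H M] [IsManifold I ∞ M]
  {E' : Type*} [NormedAddCommGroup E'] [NormedSpace ℝ E']
  {H' : Type*} [TopologicalSpace H'] {I' : ModelWithCorners ℝ E' H'}
  {Q : Type*} [TopologicalSpace Q] [ChartedSpace H' Q]

/-- The inverse of a smooth bijection whose differentials are bijective is smooth, by the inverse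
function theorem in charts. -/
theorem Equiv.contMDiff_symm_of_mfderiv_bijective (e : M ≃ Q) (he : ContMDiff I I' ∞ e)
    (hd : ∀ m, Function.Bijective (mfderiv I I' e m)) : ContMDiff I' I ∞ e.symm := by
  have : CompleteSpace E := FiniteDimensional.complete ℝ E
  intro y
  obtain ⟨m, rfl⟩ := e.surjective y
  set c := extChartAt I m with hc
  set c' := extChartAt I' (e m) with hc'
  let f : E → E' := writtenInExtChartAt I I' m e
  have hfs : ContDiffAt ℝ ∞ f (c m) := by
    have h := (contMDiffAt_iff.1 (he.contMDiffAt (x := m))).2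
    rwa [I.range_eq_univ, contDiffWithinAt_univ] at h
  obtain ⟨A, hA, hfA⟩ : ∃ A : E →L[ℝ] E', Function.Bijective A ∧
      HasFDerivWithinAt f A (range I) (c m) :=
    ⟨mfderiv I I' e m, hd m, (he.mdifferentiable (by simp) m).hasMFDerivAt.2⟩
  rw [I.range_eq_univ, hasFDerivWithinAt_univ] at hfA
  let L : E ≃L[ℝ] E' := (LinearEquiv.ofBijective A.toLinearMap hA).toContinuousLinearEquiv
  have hfL : HasFDerivAt f (L : E →L[ℝ] E') (c m) :=
    hfA.congr_fderiv (ContinuousLinearMap.ext fun _ => rfl)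
  have hn : (∞ : WithTop ℕ∞) ≠ 0 := by simp
  have hfm : f (c m) = c' (e m) := by
    simp only [f, writtenInExtChartAt, Function.comp_apply, hc, hc', extChartAt_to_inv]
  let h := hfs.localInverse hfL hn
  have hh : ContDiffAt ℝ ∞ h (c' (e m)) := hfm ▸ hfs.to_localInverse hfL hn
  have hhm : h (c' (e m)) = c m := hfm ▸ hfs.localInverse_apply_image hfL hn
  have hright : ∀ᶠ z in 𝓝 (c' (e m)), f (h z) = z :=
    hfm ▸ (hfs.hasStrictFDerivAt' hfL hn).eventually_right_inverse
  let k : Q → M := fun y => c.symm (h (c' y))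
  have hk : ContMDiffAt I' I ∞ k (e m) := by
    have h1 : ContMDiffAt I' 𝓘(ℝ, E') ∞ c' (e m) := contMDiffAt_extChartAt
    have h2 : ContMDiffAt 𝓘(ℝ, E) I ∞ c.symm (h (c' (e m))) := by
      rw [hhm]
      exact (contMDiffOn_extChartAt_symm m).contMDiffAt (extChartAt_target_mem_nhds m)
    exact h2.comp (e m) (hh.contMDiffAt.comp (e m) h1)
  have hkm : k (e m) = m := by
    simp only [k, hhm, hc, extChartAt_to_inv]
  have hek : ∀ᶠ y in 𝓝 (e m), e (k y) = y := by
    have h1 : ∀ᶠ y in 𝓝 (e m), f (h (c' y)) = c' y :=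
      (continuousAt_extChartAt (I := I') (e m)).eventually hright
    have h2 : ∀ᶠ y in 𝓝 (e m), y ∈ c'.source := extChartAt_source_mem_nhds (I := I') (e m)
    have h3 : ContinuousAt (fun y => e (k y)) (e m) :=
      he.continuous.continuousAt.comp hk.continuousAt
    have h4 : ∀ᶠ y in 𝓝 (e m), e (k y) ∈ c'.source := by
      refine h3.eventually ?_
      simpa only [hkm] using h2
    filter_upwards [h1, h2, h4] with y y1 y2 y4
    exact c'.injOn y4 y2 y1
  refine hk.congr_of_eventuallyEq ?_
  filter_upwards [hek] with y hy
  rw [← hy, e.symm_apply_apply, hy]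

end InverseFunction

/-! ### Uniqueness of the quotient -/

namespace HyperkahlerData

variable {E : Type*} [NormedAddCommGroup E] [NormedSpace ℝ E]
  {H : Type*} [TopologicalSpace H] {I : ModelWithCorners ℝ E H}
  {M : Type*} [TopologicalSpace M] [ChartedSpace H M] [IsManifold I ∞ M]
  {S : HyperkahlerData I M} {T : ∀ m : M, TangentSpace I m} {a : ℝ} {x : Fin 3 → M → ℝ}
  {φ : ℝ → M → M} {c : Fin 3 → ℝ}
  {E' : Type*} [NormedAddCommGroup E'] [NormedSpace ℝ E']
  {H' : Type*} [TopologicalSpace H'] {I' : ModelWithCorners ℝ E' H'}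
  {Q : Type*} [TopologicalSpace Q] [ChartedSpace H' Q] [IsManifold I' ∞ Q]
  {SQ : HyperkahlerData I' Q}

/-- The differential of a quotient map kills the generator of the action, as the map is constant
along the orbits. -/
theorem IsQuotient.apply_field {π : M → Q} (hQ : S.IsQuotient φ T x c SQ π)
    (hT : S.IsTriHamiltonian φ T x) (hS : S.IsAlmostHyperhermitian) {m : M}
    (hm : m ∈ levelSet x c) {D : TangentSpace I m →L[ℝ] TangentSpace I' (π m)}
    (hD : HasMFDerivWithinAt I I' π (levelSet x c) m D) : D (T m) = 0 := by
  have hmem : ∀ t, φ t m ∈ levelSet x c := fun t i => by rw [hT.moment_flow hS, hm i]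
  have hconst : π ∘ (fun t => φ t m) = fun _ => π m := by
    funext t
    exact ((hQ.fibres m hm _ (hmem t)).2 ⟨t, rfl⟩).symm
  have h1 : HasMFDerivAt 𝓘(ℝ, ℝ) I (fun t => φ t m) 0
      (ContinuousLinearMap.smulRight (1 : ℝ →L[ℝ] ℝ) (T m : E) : ℝ →L[ℝ] E) := by
    refine (hT.generator m 0).congr_mfderiv ?_
    exact congrArg (fun p => (ContinuousLinearMap.smulRight (1 : ℝ →L[ℝ] ℝ) (T p : E) : ℝ →L[ℝ] E))
      (hT.action_zero m)
  have h2 : HasMFDerivWithinAt I I' π (levelSet x c) (φ 0 m) (D : E →L[ℝ] E') := by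
    have h : ∀ p, p = m → HasMFDerivWithinAt I I' π (levelSet x c) p (D : E →L[ℝ] E') := by
      rintro p rfl
      exact hD
    exact h _ (hT.action_zero m)
  have h3 := HasMFDerivWithinAt.comp (s := univ) (0 : ℝ) h2 h1.hasMFDerivWithinAt
    (show univ ⊆ (fun t => φ t m) ⁻¹' levelSet x c from fun t _ => hmem t)
  obtain ⟨L, hL, hL'⟩ : ∃ L : ℝ →L[ℝ] E', L 1 = D ((1 : ℝ) • T m) ∧
      HasMFDerivAt 𝓘(ℝ, ℝ) I' (fun _ : ℝ => π m) 0 L :=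
    ⟨_, rfl, hconst ▸ hasMFDerivWithinAt_univ.1 h3⟩
  have h4 := hasMFDerivAt_unique hL' (hasMFDerivAt_const (I := 𝓘(ℝ, ℝ)) (I' := I') (π m) (0 : ℝ))
  rw [one_smul] at hL
  exact hL.symm.trans (congrArg (fun L : ℝ →L[ℝ] E' => L 1) h4)

/-- A diffeomorphism which matches the Kähler forms is an isomorphism: the forms determine the
complex structures by `ω_i(I_{i+1} X, Y) = ω_{i+2}(X, Y)`, and hence the metric. -/
theorem isIso_of_kahlerForm (hS : S.IsAlmostHyperhermitian) (hSQ : SQ.IsAlmostHyperhermitian)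
    (Φ : M ≃ₘ^∞⟮I, I'⟯ Q)
    (hsurj : ∀ m, Function.Surjective (mfderiv I I' Φ m))
    (h : ∀ (i : Fin 3) (m : M) (X Y : TangentSpace I m),
      SQ.kahlerForm i (Φ m) (mfderiv I I' Φ m X) (mfderiv I I' Φ m Y) = S.kahlerForm i m X Y) :
    S.IsIso SQ Φ := by
  have hJ : ∀ (i : Fin 3) (m : M) (X : TangentSpace I m),
      mfderiv I I' Φ m (S.J (i + 1) m X) = SQ.J (i + 1) (Φ m) (mfderiv I I' Φ m X) := by
    intro i m X
    refine sub_eq_zero.1 (hSQ.eq_zero_of_kahlerForm i (Φ m) fun Z => ?_)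
    obtain ⟨Y, rfl⟩ := hsurj m Z
    have h1 := h i m (S.J (i + 1) m X) Y
    have h2 := h (i + 2) m X Y
    simp only [kahlerForm, map_sub, sub_apply, hS.J_mul, hSQ.J_mul] at h1 h2 ⊢
    rw [h1, h2, sub_self]
  have hJ' : ∀ (i : Fin 3) (m : M) (X : TangentSpace I m),
      mfderiv I I' Φ m (S.J i m X) = SQ.J i (Φ m) (mfderiv I I' Φ m X) := by
    intro i m X
    have := hJ (i - 1) m X
    rwa [sub_add_cancel] at this
  refine ⟨fun m X Y => ?_, hJ', h⟩
  have h1 := h 0 m (S.J 0 m X) Y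
  simpa only [kahlerForm, hJ', hS.J_sq, hSQ.J_sq, map_neg, neg_apply, neg_inj] using h1

namespace IsTriHamiltonian

variable (hT : S.IsTriHamiltonian φ T x)
include hT

theorem contMDiff_taubNUTSlice :
    ContMDiff I (I.prod 𝓘(ℝ, ℍ[ℝ])) ∞ (taubNUTSlice a x c) := by
  refine contMDiff_id.prodMk (ContMDiff.sum fun i _ => ?_)
  exact ((contMDiff_const.mul (hT.moment_smooth i)).sub contMDiff_const).smul contMDiff_const

theorem mfderiv_taubNUTSlice_fst (m : M) (X : TangentSpace I m) :
    ((mfderiv I (I.prod 𝓘(ℝ, ℍ[ℝ])) (taubNUTSlice a x c) m X : E × ℍ[ℝ]).1 : E) = X := by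
  have h := (hasMFDerivAt_fst (I := I) (I' := 𝓘(ℝ, ℍ[ℝ])) (taubNUTSlice a x c m)).comp m
    (hT.contMDiff_taubNUTSlice.mdifferentiable (by simp) m).hasMFDerivAt
  exact congrArg (fun L : E →L[ℝ] E => L X) (hasMFDerivAt_unique h (hasMFDerivAt_id m))

/-- A function which is constant on the slice has zero derivative along it. -/
theorem mvfderiv_apply_mfderiv_taubNUTSlice {f : M × ℍ[ℝ] → ℝ} {m : M}
    (hf : MDifferentiableAt (I.prod 𝓘(ℝ, ℍ[ℝ])) 𝓘(ℝ, ℝ) f (taubNUTSlice a x c m)) {b : ℝ}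
    (hb : ∀ m, f (taubNUTSlice a x c m) = b) (X : TangentSpace I m) :
    mvfderiv (I.prod 𝓘(ℝ, ℍ[ℝ])) f (taubNUTSlice a x c m)
      (mfderiv I (I.prod 𝓘(ℝ, ℍ[ℝ])) (taubNUTSlice a x c) m X) = 0 := by
  have h := hf.hasMFDerivAt.comp m
    (hT.contMDiff_taubNUTSlice.mdifferentiable (by simp) m).hasMFDerivAt
  have h' : f ∘ taubNUTSlice a x c = fun _ => b := funext hb
  rw [h'] at h
  exact congrArg (fun L : E →L[ℝ] ℝ => L X)
    (hasMFDerivAt_unique h (hasMFDerivAt_const (I' := 𝓘(ℝ, ℝ)) b m))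

theorem re_mfderiv_taubNUTSlice (m : M) (X : TangentSpace I m) :
    ((mfderiv I (I.prod 𝓘(ℝ, ℍ[ℝ])) (taubNUTSlice a x c) m X : E × ℍ[ℝ]).2 : ℍ[ℝ]).re = 0 := by
  have h : HasMFDerivAt (I.prod 𝓘(ℝ, ℍ[ℝ])) 𝓘(ℝ, ℝ) (fun p : M × ℍ[ℝ] => innerSL ℝ (1 : ℍ[ℝ]) p.2)
      (taubNUTSlice a x c m) _ :=
    (innerSL ℝ (1 : ℍ[ℝ])).hasMFDerivAt.comp _ (hasMFDerivAt_snd (I := I) (I' := 𝓘(ℝ, ℍ[ℝ])) _)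
  have h0 : ∀ q : ℍ[ℝ], inner ℝ (1 : ℍ[ℝ]) q = q.re := fun q => by simp [quaternion_inner_eq]
  have h1 := hT.mvfderiv_apply_mfderiv_taubNUTSlice h.mdifferentiableAt (b := 0) (fun m =>
    (h0 _).trans (re_sum_smul_quaternionUnit _)) X
  have h2 := congrArg (fun L : E × ℍ[ℝ] →L[ℝ] ℝ =>
    L (mfderiv I (I.prod 𝓘(ℝ, ℍ[ℝ])) (taubNUTSlice a x c) m X)) h.mfderiv
  exact (h0 _).symm.trans (h2.symm.trans h1)

theorem mvfderiv_taubNUTMoment_mfderiv_taubNUTSlice (hS : S.IsAlmostHyperhermitian)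
    [FiniteDimensional ℝ E] (i : Fin 3) (m : M) (X : TangentSpace I m) :
    mvfderiv (I.prod 𝓘(ℝ, ℍ[ℝ])) (taubNUTMoment a x i) (taubNUTSlice a x c m)
      (mfderiv I (I.prod 𝓘(ℝ, ℍ[ℝ])) (taubNUTSlice a x c) m X) = 0 :=
  hT.mvfderiv_apply_mfderiv_taubNUTSlice
    (((hT.prodQuaternion hS).moment_smooth i).mdifferentiable (by simp) _)
    (fun m => taubNUTSlice_mem a x c m i) X

/-- A vector tangent to the level set and to `{q₀ = 0}` is tangent to the slice. -/
theorem mfderiv_taubNUTSlice_eq (hS : S.IsAlmostHyperhermitian) [FiniteDimensional ℝ E] {m : M}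
    {W : TangentSpace (I.prod 𝓘(ℝ, ℍ[ℝ])) (taubNUTSlice a x c m)}
    (hW : ∀ i, mvfderiv (I.prod 𝓘(ℝ, ℍ[ℝ])) (taubNUTMoment a x i) (taubNUTSlice a x c m) W = 0)
    (h0 : (W.2 : ℍ[ℝ]).re = 0) :
    mfderiv I (I.prod 𝓘(ℝ, ℍ[ℝ])) (taubNUTSlice a x c) m (W.1 : E) = W := by
  have hfst := hT.mfderiv_taubNUTSlice_fst (a := a) (c := c) m W.1
  refine Prod.ext hfst (quaternion_ext_of_inner ?_ fun i => ?_)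
  · exact (hT.re_mfderiv_taubNUTSlice m _).trans h0.symm
  · refine (hT.inner_quaternionUnit_of_mvfderiv_eq_zero
      (fun i => hT.mvfderiv_taubNUTMoment_mfderiv_taubNUTSlice hS i m _) i).trans ?_
    refine Eq.trans ?_ (hT.inner_quaternionUnit_of_mvfderiv_eq_zero hW i).symm
    exact congrArg (fun v : E => a * (mvfderiv I (x i) m : E →L[ℝ] ℝ) v) hfst

/-- A quotient map factors over `M × ℍ → M` on the level set. -/
theorem quotient_apply_taubNUTSlice (hS : S.IsAlmostHyperhermitian) {π : M × ℍ[ℝ] → Q}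
    (hQ : S.prodQuaternion.IsQuotient (taubNUTAction a φ) (taubNUTField a T)
      (taubNUTMoment a x) c SQ π) {p : M × ℍ[ℝ]} (hp : p ∈ levelSet (taubNUTMoment a x) c) :
    π (taubNUTSlice a x c (taubNUTProj a φ p)) = π p := by
  have hm := taubNUTSlice_mem a x c (taubNUTProj a φ p)
  rw [hQ.fibres _ hm _ hp, ← hT.taubNUTProj_eq_iff hS hm hp, hT.taubNUTProj_taubNUTSlice]

/-- The slice `{q₀ = 0}` meets every orbit of the level set once. -/
theorem bijective_quotient_comp_taubNUTSlice (hS : S.IsAlmostHyperhermitian) {π : M × ℍ[ℝ] → Q}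
    (hQ : S.prodQuaternion.IsQuotient (taubNUTAction a φ) (taubNUTField a T)
      (taubNUTMoment a x) c SQ π) : Function.Bijective (π ∘ taubNUTSlice a x c) := by
  constructor
  · intro m m' h
    rw [Function.comp_apply, Function.comp_apply, hQ.fibres _ (taubNUTSlice_mem a x c m) _
      (taubNUTSlice_mem a x c m'), ← hT.taubNUTProj_eq_iff hS (taubNUTSlice_mem a x c m)
      (taubNUTSlice_mem a x c m'), hT.taubNUTProj_taubNUTSlice, hT.taubNUTProj_taubNUTSlice] at h
    exact h
  · intro q
    obtain ⟨p, hp, rfl⟩ := hQ.surjective q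
    exact ⟨taubNUTProj a φ p, hT.quotient_apply_taubNUTSlice hS hQ hp⟩

/-- The slice `{q₀ = 0}` identifies `M` with every quotient. -/
theorem exists_diffeomorph_isIso [FiniteDimensional ℝ E] [T2Space M] [I.Boundaryless]
    (hS : S.IsHyperkahler) {π : M × ℍ[ℝ] → Q}
    (hQ : S.prodQuaternion.IsQuotient (taubNUTAction a φ) (taubNUTField a T)
      (taubNUTMoment a x) c SQ π) :
    ∃ Φ : M ≃ₘ^∞⟮I, I'⟯ Q, (S.taubNUT T a).IsIso SQ Φ := by
  have hA := hS.isAlmostHyperhermitian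
  have hTA := (hS.taubNUT (a := a) hT).isAlmostHyperhermitian
  have hP := hT.prodQuaternion (a := a) hA
  have hmem := taubNUTSlice_mem a x c
  let e : M ≃ Q := Equiv.ofBijective _ (hT.bijective_quotient_comp_taubNUTSlice hA hQ)
  have he : ContMDiff I I' ∞ e := hQ.smooth.comp_contMDiff hT.contMDiff_taubNUTSlice hmem
  have hd : ∀ m, Function.Surjective (mfderiv I I' e m) ∧ ∀ (i : Fin 3) (X Y : TangentSpace I m),
      SQ.kahlerForm i (e m) (mfderiv I I' e m X) (mfderiv I I' e m Y) =
        (S.taubNUT T a).kahlerForm i m X Y := by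
    intro m
    obtain ⟨D, hD, hDs, hDω, -⟩ := hQ.submersion _ (hmem m)
    have h1 := HasMFDerivWithinAt.comp m hD
      (hT.contMDiff_taubNUTSlice.mdifferentiable (by simp) m).hasMFDerivAt.hasMFDerivWithinAt
      (fun m (_ : m ∈ univ) => hmem m)
    rw [hasMFDerivWithinAt_univ] at h1
    have h2 : ∀ X : TangentSpace I m, (mfderiv I I' e m X : E') =
        D (mfderiv I (I.prod 𝓘(ℝ, ℍ[ℝ])) (taubNUTSlice a x c) m X) := fun X =>
      congrArg (fun L : E →L[ℝ] E' => L X) h1.mfderiv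
    have hZ := hQ.apply_field hP hA.prodQuaternion (hmem m) hD
    refine ⟨fun v => ?_, fun i X Y => ?_⟩
    · obtain ⟨W, hW, rfl⟩ := hDs v
      -- subtract the multiple of the generator which makes the vector tangent to the slice
      let Z := taubNUTField a T (taubNUTSlice a x c m)
      let r : ℝ := (W.2 : ℍ[ℝ]).re
      have hW' : ∀ i, mvfderiv (I.prod 𝓘(ℝ, ℍ[ℝ])) (taubNUTMoment a x i) (taubNUTSlice a x c m)
          (W - r • Z) = 0 := fun i => by
        rw [map_sub, map_smul, hW, hP.mvfderiv_moment_field hA.prodQuaternion, smul_zero, sub_zero]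
      have hr : (W.2 : ℍ[ℝ]).re - r * (1 : ℍ[ℝ]).re = 0 := by simp [r]
      refine ⟨(W - r • Z).1, ?_⟩
      refine (h2 _).trans ((congrArg D (hT.mfderiv_taubNUTSlice_eq hA hW' hr)).trans ?_)
      rw [map_sub, map_smul, hZ, smul_zero, sub_zero]
    · refine (congrArg₂ (fun u v : E' => SQ.kahlerForm i (e m) u v) (h2 X) (h2 Y)).trans ?_
      have hX := fun i => hT.mvfderiv_taubNUTMoment_mfderiv_taubNUTSlice (a := a) (c := c) hA i m X
      have hY := fun i => hT.mvfderiv_taubNUTMoment_mfderiv_taubNUTSlice (a := a) (c := c) hA i m Y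
      refine (hDω i _ _ hX hY).trans ?_
      refine (hT.taubNUT_kahlerForm_sub_smul hA i m _ _ _ _
        (hT.inner_quaternionUnit_of_mvfderiv_eq_zero hX)
        (hT.inner_quaternionUnit_of_mvfderiv_eq_zero hY)).symm.trans ?_
      have h3 : ∀ (X X' : TangentSpace I m) (q : ℍ[ℝ]), X' = X → q.re = 0 →
          X' - (a * q.re) • T m = X := by
        rintro X X' q rfl h
        rw [h, mul_zero, zero_smul, sub_zero]
      exact congrArg₂ (fun u v : E => (S.taubNUT T a).kahlerForm i m u v)
        (h3 X _ _ (hT.mfderiv_taubNUTSlice_fst m X) (hT.re_mfderiv_taubNUTSlice m X))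
        (h3 Y _ _ (hT.mfderiv_taubNUTSlice_fst m Y) (hT.re_mfderiv_taubNUTSlice m Y))
  have hinj : ∀ m, Function.Injective (mfderiv I I' e m) := by
    intro m
    rw [injective_iff_map_eq_zero]
    intro X hX
    refine hTA.eq_zero_of_kahlerForm 0 m fun Y => ?_
    rw [← (hd m).2, hX]
    simp [kahlerForm]
  let Φ : M ≃ₘ^∞⟮I, I'⟯ Q :=
    ⟨e, he, e.contMDiff_symm_of_mfderiv_bijective he fun m => ⟨hinj m, (hd m).1⟩⟩
  exact ⟨Φ, isIso_of_kahlerForm hTA hQ.hyperkahler.isAlmostHyperhermitian Φ (fun m => (hd m).1)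
    fun i m => (hd m).2 i⟩

end IsTriHamiltonian

end HyperkahlerData

end

theorem mainTheorem7 {E : Type*} [NormedAddCommGroup E] [NormedSpace ℝ E] [FiniteDimensional ℝ E]
    {H : Type*} [TopologicalSpace H] {I : ModelWithCorners ℝ E H} [I.Boundaryless]
    {M : Type*} [TopologicalSpace M] [ChartedSpace H M] [IsManifold I ∞ M] [T2Space M]
    (S : HyperkahlerData I M) (hS : S.IsHyperkahler)
    (φ : ℝ → M → M) (T : ∀ m : M, TangentSpace I m) (x : Fin 3 → M → ℝ)
    (hT : S.IsTriHamiltonian φ T x) (a : ℝ) (ha : 0 < a) :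
    S.prodQuaternion.IsHyperkahler ∧
    S.prodQuaternion.IsTriHamiltonian (taubNUTAction a φ) (taubNUTField a T)
      (taubNUTMoment a x) ∧
    ∃ Sa : HyperkahlerData I M, Sa.IsHyperkahler ∧ Sa.IsInvariant φ ∧
      (∀ m : M, T m ≠ 0 →
        (∀ X Y : TangentSpace I m,
          Sa.g m X Y = S.gBar T m X Y
            + (S.V T m + a ^ 2) * ∑ i : Fin 3, mvfderiv I (x i) m X * mvfderiv I (x i) m Y
            + 1 / (S.V T m + a ^ 2) * (S.η T m X * S.η T m Y)) ∧
        (∀ (i : Fin 3) (X : TangentSpace I m),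
          Sa.J i m X = S.J i m X
            - (a ^ 2 * S.V T m / (a ^ 2 + S.V T m) * S.θ T m X) • S.J i m (T m)
            + (a ^ 2 * mvfderiv I (x i) m X) • T m) ∧
        (∀ (i : Fin 3) (X Y : TangentSpace I m),
          Sa.kahlerForm i m X Y = S.kahlerForm i m X Y
            + a ^ 2 * (mvfderiv I (x (i + 1)) m X * mvfderiv I (x (i + 2)) m Y
              - mvfderiv I (x (i + 1)) m Y * mvfderiv I (x (i + 2)) m X))) ∧
      ∀ c : Fin 3 → ℝ,
        (∃ π : M × ℍ[ℝ] → M,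
          S.prodQuaternion.IsQuotient (taubNUTAction a φ) (taubNUTField a T)
            (taubNUTMoment a x) c Sa π) ∧
        ∀ {E' : Type*} [NormedAddCommGroup E'] [NormedSpace ℝ E'] [FiniteDimensional ℝ E']
          {H' : Type*} [TopologicalSpace H'] {I' : ModelWithCorners ℝ E' H'} [I'.Boundaryless]
          {Q : Type*} [TopologicalSpace Q] [ChartedSpace H' Q] [IsManifold I' ∞ Q] [T2Space Q]
          (SQ : HyperkahlerData I' Q) (π : M × ℍ[ℝ] → Q),
          S.prodQuaternion.IsQuotient (taubNUTAction a φ) (taubNUTField a T)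
            (taubNUTMoment a x) c SQ π →
          ∃ Φ : M ≃ₘ^∞⟮I, I'⟯ Q, Sa.IsIso SQ Φ := by
  have hA := hS.isAlmostHyperhermitian
  refine ⟨hS.prodQuaternion, hT.prodQuaternion hA, S.taubNUT T a, hS.taubNUT hT,
    hT.taubNUT_isInvariant hA, fun m hm => ⟨hT.taubNUT_g hS hm, hT.taubNUT_J hS hm,
      fun i => hT.taubNUT_kahlerForm hA i m⟩, fun c => ⟨⟨taubNUTProj a φ, hT.isQuotient_taubNUT hS c⟩,
      ?_⟩⟩
  intro E' _ _ _ H' _ I' _ Q _ _ _ _ SQ π hQ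
  exact hT.exists_diffeomorph_isIso hS hQ
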